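/- All systems are real, finite-dimensional and linear time-invariant, $\dot x=Ax+Bu$, $y=Cx+Du$, given by minimal (controllable and observable) realizations. Let $\mathbf P$ and $\mathbf P_n$ $(n\in\mathbb N)$ have $p$ inputs and $q$ outputs (the state dimension of $\mathbf P_n$ may depend on $n$), and let $\mathbf C$ have $q$ inputs and $p$ outputs. The feedback loop $[\mathbf P,\mathbf C]$ is given by $u_0=u_1+u_2$, $y_0=y_1+y_2$, $y_1=\mathbf Pu_1$, $u_2=\mathbf Cy_2$; it is called f-stable if it is well-posed (the matrix $\begin{pmatrix} I & D_C\\ D_P& I\end{pmatrix}$ is invertible) and the state matrix of the combined state-space system is Hurwitz, i.e. all its eigenvalues have negative real part. A graph symbol of a system with transfer function $P(s)=C(sI-A)^{-1}B+D$ is $$G(s)=\begin{pmatrix} m(s)\,d(s)^{-1}\\ n(s)\,d(s)^{-1}\end{pmatrix},$$ where $P=nm^{-1}$ with $n,m$ right-coprime real polynomial matrices, and $d$ is a square real polynomial matrix such that $n(-s)^Tn(s)+m(-s)^Tm(s)=d(-s)^Td(s)$ and $\det d$ is a Hurwitz polynomial. Let $G$ and $G_n$ be graph symbols of $\mathbf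 P$ and $\mathbf P_n$. With $\mathcal L_2=\mathcal L_2(-j\infty,j\infty)$, the $\mathcal L_2$-gap is $$\delta_{\mathcal L_2}(\mathbf P_n,\mathbf P)=\|\Pi_{G_n\mathcal L_2}-\Pi_{G\mathcal L_2}\|,$$ where $\Pi_{\mathcal K}$ is the orthogonal projection onto the closed subspace $\mathcal K$. For a function $g$ without poles on the imaginary axis, $\mathrm{wno}(g)$ denotes the winding number about the origin of $g(s)$ as $s$ traces the Nyquist D-contour (the imaginary axis from $-jR$ to $jR$, closed by the semicircle of radius $R$ in the right half plane), for all sufficiently large $R$; $\mathrm{wno}(g)=0$ includes that $g$ has neither zeros nor poles on these contours. **Proposition.** Let $[\mathbf P,\mathbf C]$ be f-stable and suppose $\delta_{\mathcal L_2}(\mathbf P_n,\mathbf P)\to 0$ as $n\to\infty$. Then $[\mathbf P_n,\mathbf C]$ is f-stable for all sufficiently large $n$ if and only if $\mathrm{wno}\big(\det(G_n(-s)^TG(s))\big)=0$ for all sufficiently large $n$. -/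

import Mathlib

open Filter Topology MeasureTheory Matrix
open scoped Polynomial

noncomputable section

/-! ### State-space systems -/

/-- A real finite-dimensional linear time-invariant system `ẋ = A x + B u`, `y = C x + D u`,
with states indexed by `σ`, inputs by `ι` and outputs by `o`. -/
structure StateSpace (σ ι o : Type) where
  A : Matrix σ σ ℝ
  B : Matrix σ ι ℝ
  C : Matrix o σ ℝ
  D : Matrix o ι ℝ

/-- A real square matrix is Hurwitz if all its complex eigenvalues have negative real part. -/
def Matrix.IsHurwitz {σ : Type} [Fintype σ] [DecidableEq σ] (A : Matrix σ σ ℝ) : Prop :=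
  ∀ z ∈ spectrum ℂ (A.map Complex.ofReal), z.re < 0

/-- A real polynomial is Hurwitz if it is nonzero and all its complex roots have negative real
part. -/
def Polynomial.IsHurwitz (f : ℝ[X]) : Prop :=
  f ≠ 0 ∧ ∀ z : ℂ, Polynomial.aeval z f = 0 → z.re < 0

namespace StateSpace

variable {σ τ ι o : Type} [Fintype σ] [DecidableEq σ] [Fintype τ] [DecidableEq τ]
  [Fintype ι] [DecidableEq ι] [Fintype o] [DecidableEq o]

/-- The vectors `Aⁱ B u` span the state space. -/
def IsControllable (P : StateSpace σ ι o) : Prop :=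
  Submodule.span ℝ (Set.range fun z : ℕ × (ι → ℝ) => (P.A ^ z.1 * P.B) *ᵥ z.2) = ⊤

/-- A state `x` with `C Aⁱ x = 0` for all `i` is zero. -/
def IsObservable (P : StateSpace σ ι o) : Prop :=
  ∀ x : σ → ℝ, (∀ i : ℕ, (P.C * P.A ^ i) *ᵥ x = 0) → x = 0

/-- Minimal realization: controllable and observable. -/
def IsMinimal (P : StateSpace σ ι o) : Prop :=
  P.IsControllable ∧ P.IsObservable

/-- f-stability of a system: `A` is Hurwitz. -/
def IsFStable (P : StateSpace σ ι o) : Prop :=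
  P.A.IsHurwitz

/-- The transfer function `C (sI - A)⁻¹ B + D`, a matrix of real rational functions. -/
def transfer (P : StateSpace σ ι o) : Matrix o ι (RatFunc ℝ) :=
  P.C.map RatFunc.C * (Matrix.scalar σ RatFunc.X - P.A.map RatFunc.C)⁻¹ * P.B.map RatFunc.C
    + P.D.map RatFunc.C

/-- The matrix `[I, D_C; D_P, I]` of the algebraic part of the feedback loop. -/
def loopMatrix (P : StateSpace σ ι o) (C : StateSpace τ o ι) : Matrix (ι ⊕ o) (ι ⊕ o) ℝ :=
  Matrix.fromBlocks 1 C.D P.D 1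

/-- The combined state-space system of the feedback interconnection
`u₀ = u₁ + u₂`, `y₀ = y₁ + y₂`, `y₁ = P u₁`, `u₂ = C y₂`,
with input `(u₀, y₀)` and output `(u₁, y₁)`. It is obtained by solving
`[I, D_C; D_P, I] (u₁, y₂) = (u₀ - C_C x_C, y₀ - C_P x_P)`, so it is meaningful when the loop
matrix is invertible. -/
def feedback (P : StateSpace σ ι o) (C : StateSpace τ o ι) :
    StateSpace (σ ⊕ τ) (ι ⊕ o) (ι ⊕ o) where
  A := Matrix.fromBlocks P.A 0 0 C.A -
    Matrix.fromBlocks P.B 0 0 C.B * (loopMatrix P C)⁻¹ * Matrix.fromBlocks 0 C.C P.C 0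
  B := Matrix.fromBlocks P.B 0 0 C.B * (loopMatrix P C)⁻¹
  C := Matrix.fromBlocks 0 0 P.C 0 -
    Matrix.fromBlocks 1 0 P.D 0 * (loopMatrix P C)⁻¹ * Matrix.fromBlocks 0 C.C P.C 0
  D := Matrix.fromBlocks 1 0 P.D 0 * (loopMatrix P C)⁻¹

/-- The feedback loop `[P, C]` is f-stable: it is well-posed and the combined state-space system
is f-stable. -/
def FeedbackFStable (P : StateSpace σ ι o) (C : StateSpace τ o ι) : Prop :=
  IsUnit (loopMatrix P C).det ∧ (feedback P C).IsFStable

end StateSpace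

/-! ### Graph symbols -/

/-- Substitution `s ↦ -s` in a polynomial matrix. -/
def Matrix.polyNeg {κ ι : Type} (M : Matrix κ ι ℝ[X]) : Matrix κ ι ℝ[X] :=
  M.map fun f => f.comp (-Polynomial.X)

/-- Value of a real polynomial matrix at a complex number. -/
def Matrix.polyEval {κ ι : Type} (M : Matrix κ ι ℝ[X]) (s : ℂ) : Matrix κ ι ℂ :=
  M.map fun f => Polynomial.aeval s f

/-- A graph symbol `G = (m d⁻¹ ; n d⁻¹)` of the system `P`: here `P = n m⁻¹` with `n`, `m`
right-coprime polynomial matrices, and `d` is a polynomial matrix with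
`n(-s)ᵀ n(s) + m(-s)ᵀ m(s) = d(-s)ᵀ d(s)` and `det d` Hurwitz. -/
structure GraphSymbol {σ ι o : Type} [Fintype σ] [DecidableEq σ] [Fintype ι] [DecidableEq ι]
    [Fintype o] [DecidableEq o] (P : StateSpace σ ι o) where
  m : Matrix ι ι ℝ[X]
  n : Matrix o ι ℝ[X]
  d : Matrix ι ι ℝ[X]
  det_m_ne_zero : m.det ≠ 0
  transfer_eq : P.transfer =
    n.map (algebraMap ℝ[X] (RatFunc ℝ)) * (m.map (algebraMap ℝ[X] (RatFunc ℝ)))⁻¹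
  coprime : ∃ (X : Matrix ι ι ℝ[X]) (Y : Matrix ι o ℝ[X]), X * m + Y * n = 1
  factor : n.polyNegᵀ * n + m.polyNegᵀ * m = d.polyNegᵀ * d
  hurwitz : d.det.IsHurwitz

namespace GraphSymbol

variable {σ σ₁ σ₂ ι o : Type} [Fintype σ] [DecidableEq σ] [Fintype σ₁] [DecidableEq σ₁]
  [Fintype σ₂] [DecidableEq σ₂] [Fintype ι] [DecidableEq ι] [Fintype o] [DecidableEq o]

/-- The value `G(s) = (m(s) d(s)⁻¹ ; n(s) d(s)⁻¹)`, meaningful wherever `d(s)` is invertible (in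
particular on the closed right half plane). -/
def eval {P : StateSpace σ ι o} (G : GraphSymbol P) (s : ℂ) : Matrix (ι ⊕ o) ι ℂ :=
  Matrix.fromRows (G.m.polyEval s * (G.d.polyEval s)⁻¹) (G.n.polyEval s * (G.d.polyEval s)⁻¹)

/-- The graph `G(s) 𝓛₂`, where `𝓛₂ = 𝓛₂(-j∞, j∞)` is parametrized by the frequency `ω`,
`s = jω`. -/
def l2Graph {P : StateSpace σ ι o} (G : GraphSymbol P) :
    Submodule ℂ (Lp (EuclideanSpace ℂ (ι ⊕ o)) 2 (volume : Measure ℝ)) where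
  carrier := {w | ∃ v : Lp (EuclideanSpace ℂ ι) 2 (volume : Measure ℝ),
    ∀ᵐ ω : ℝ, w ω = WithLp.toLp 2 (G.eval (Complex.I * ω) *ᵥ (v ω).ofLp)}
  add_mem' := by
    rintro a b ⟨v, hv⟩ ⟨w, hw⟩
    refine ⟨v + w, ?_⟩
    filter_upwards [hv, hw, Lp.coeFn_add a b, Lp.coeFn_add v w] with ω h1 h2 h3 h4
    rw [h3, h4, Pi.add_apply, Pi.add_apply, h1, h2, WithLp.ofLp_add, Matrix.mulVec_add,
      WithLp.toLp_add]
  zero_mem' := by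
    refine ⟨0, ?_⟩
    filter_upwards [Lp.coeFn_zero (EuclideanSpace ℂ (ι ⊕ o)) 2 (volume : Measure ℝ),
      Lp.coeFn_zero (EuclideanSpace ℂ ι) 2 (volume : Measure ℝ)] with ω h1 h2
    rw [h1, h2]; simp
  smul_mem' := by
    rintro c a ⟨v, hv⟩
    refine ⟨c • v, ?_⟩
    filter_upwards [hv, Lp.coeFn_smul c a, Lp.coeFn_smul c v] with ω h1 h2 h3
    rw [h2, h3, Pi.smul_apply, Pi.smul_apply, h1, WithLp.ofLp_smul, Matrix.mulVec_smul,
      WithLp.toLp_smul]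

/-- The `𝓛₂`-gap between two systems, given through graph symbols: the operator norm of the
difference of the orthogonal projections onto their graphs. The graphs are closed subspaces
(multiplication by a graph symbol is isometric), so that taking the closure does not change
them. The value depends only on the two systems. -/
def l2Gap {P₁ : StateSpace σ₁ ι o} {P₂ : StateSpace σ₂ ι o}
    (G₁ : GraphSymbol P₁) (G₂ : GraphSymbol P₂) : ℝ :=
  ‖G₁.l2Graph.topologicalClosure.starProjection - G₂.l2Graph.topologicalClosure.starProjection‖

end GraphSymbol

/-! ### Winding numbers -/

/-- The curve `γ` on `[a, b]` avoids the origin and has winding number `k` about it: it has a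
continuous logarithm that changes by `2πik` along the curve. -/
def HasWindingNumber (γ : ℝ → ℂ) (a b : ℝ) (k : ℤ) : Prop :=
  ∃ L : ℝ → ℂ, ContinuousOn L (Set.Icc a b) ∧ (∀ t ∈ Set.Icc a b, γ t = Complex.exp (L t)) ∧
    L b - L a = 2 * Real.pi * Complex.I * k

/-- The Nyquist D-contour of radius `R`, parametrized by `[-1, 3]`: up the imaginary axis from
`-jR` to `jR`, and back along the semicircle of radius `R` in the right half plane. -/
def nyquistContour (R : ℝ) (t : ℝ) : ℂ :=
  if t ≤ 1 then Complex.I * (R * t)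
  else R * Complex.exp (Complex.I * (Real.pi / 2 * (2 - t)))

/-- `wno(g) = k`: along the Nyquist D-contour of every sufficiently large radius, `g` does not
vanish and has winding number `k` about the origin. (Used for functions `g` without poles on the
imaginary axis, so the contour needs no indentation.) -/
def HasWno (g : ℂ → ℂ) (k : ℤ) : Prop :=
  ∀ᶠ R : ℝ in atTop, HasWindingNumber (fun t => g (nyquistContour R t)) (-1) 3 k

end

/-!
The statement holds plant by plant: if `Q`, with graph symbol `H`, is close enough to `P` in the
`𝓛₂`-gap, then `[Q, C]` is f-stable if and only if `g(s) = det (H(-s)ᵀ G(s))` has winding number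
zero (`GraphSymbol.exists_l2Gap_le_feedbackFStable_iff`).

Let `T(s)` be the transfer function of the stable loop `[P, C]`, which takes `(u₀, y₀)` to
`(u₁, y₁)`. It is the projection onto the graph of `P` along the graph of `C`, so `T G = G`. On the
imaginary axis `Gᴴ G = 1`, and the compressed loop `Gᴴ T H` satisfies
`det (Gᴴ T H) = c Φ_Q det d_G / (Φ_P det d_H)` with a nonzero constant `c`, where `Φ_P` and `Φ_Q`
are the closed-loop characteristic polynomials (`GraphSymbol.exists_det_eq_loopPoly_div`). Minimality
enters here: it makes `det m` a constant multiple of the characteristic polynomial of the state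
matrix (`GraphSymbol.det_m_eq`). Let `h` be the rational function on the right. Since `Φ_P`, `det d_G`
and `det d_H` are Hurwitz, `wno h` is minus the number of zeros of `Φ_Q` in the right half plane
(`HasWno.loop_ratio`); the contour runs clockwise.

The gap bounds `(1 - G Gᴴ) H` at every frequency (`GraphSymbol.norm_proj_compl_mul_le_l2Gap`). On the
axis `g = det (Hᴴ G)`, and `T G = G` gives `Gᴴ T H = Gᴴ H + Gᴴ T (1 - G Gᴴ) H`. Hence `g h` is
`det (1 + F)` with `F` small uniformly in the frequency, and it has positive real part on the axis
and at infinity (`Matrix.exists_re_det_mul_det_pos`). Rational functions have the same limit at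
infinity in all directions, so `g h` has positive real part on large semicircles as well, and
`wno (g h) = 0`. Therefore `wno g = 0` if and only if `wno h = 0`, that is, `Φ_Q` has no zeros in the
right half plane. It has none on the axis because `h` does not vanish there, and `[Q, C]` is
well-posed because `h` does not vanish at infinity (`GraphSymbol.isUnit_det_loopMatrix`).
-/

/-! ### Winding numbers along the Nyquist contour -/

namespace HasWindingNumber

variable {f g : ℝ → ℂ} {a b : ℝ} {k l : ℤ}

theorem congr (hf : HasWindingNumber f a b k) (h : ∀ t ∈ Set.Icc a b, f t = g t) :
    HasWindingNumber g a b k := by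
  obtain ⟨L, hc, he, hk⟩ := hf
  exact ⟨L, hc, fun t ht => (h t ht).symm.trans (he t ht), hk⟩

theorem mul (hf : HasWindingNumber f a b k) (hg : HasWindingNumber g a b l) :
    HasWindingNumber (fun t => f t * g t) a b (k + l) := by
  obtain ⟨L, hc, he, hk⟩ := hf
  obtain ⟨M, hc', he', hk'⟩ := hg
  refine ⟨fun t => L t + M t, hc.add hc', fun t ht => ?_, ?_⟩
  · simp only [he t ht, he' t ht, Complex.exp_add]
  · push_cast
    linear_combination hk + hk'

theorem inv (hf : HasWindingNumber f a b k) :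
    HasWindingNumber (fun t => (f t)⁻¹) a b (-k) := by
  obtain ⟨L, hc, he, hk⟩ := hf
  refine ⟨fun t => -L t, hc.neg, fun t ht => ?_, ?_⟩
  · simp only [he t ht, Complex.exp_neg]
  · push_cast
    linear_combination -hk

/-- Two continuous logarithms of the same curve differ by a continuous function with values in
`2πiℤ`, hence by a constant. -/
theorem unique (hab : a ≤ b) (hf : HasWindingNumber f a b k) (hf' : HasWindingNumber f a b l) :
    k = l := by
  obtain ⟨L, hc, he, hk⟩ := hf
  obtain ⟨M, hc', he', hk'⟩ := hf'
  have h2 : (2 * Real.pi * Complex.I : ℂ) ≠ 0 := Complex.two_pi_I_ne_zero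
  have hex : ∀ t ∈ Set.Icc a b, ∃ n : ℤ, L t = M t + n * (2 * Real.pi * Complex.I) := fun t ht =>
    Complex.exp_eq_exp_iff_exists_int.mp ((he t ht).symm.trans (he' t ht))
  let φ : ℝ → ℝ := fun t => ((L t - M t) / (2 * Real.pi * Complex.I)).re
  have hφ : ContinuousOn φ (Set.Icc a b) :=
    Complex.continuous_re.comp_continuousOn ((hc.sub hc').div_const _)
  have hval : ∀ t ∈ Set.Icc a b, ∃ n : ℤ, φ t = n ∧ L t = M t + n * (2 * Real.pi * Complex.I) := by
    intro t ht
    obtain ⟨n, hn⟩ := hex t ht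
    refine ⟨n, ?_, hn⟩
    simp only [φ, hn, add_sub_cancel_left, mul_div_cancel_right₀ _ h2, Complex.intCast_re]
  have hconst : φ a = φ b := by
    have hpre := isPreconnected_Icc.constant_of_mapsTo (S := Set.Icc a b)
      (T := Set.range ((↑) : ℤ → ℝ)) (f := φ) ?_ hφ ?_
      (Set.left_mem_Icc.mpr hab) (Set.right_mem_Icc.mpr hab)
    · exact hpre
    · exact (Int.isClosedEmbedding_coe_real.isEmbedding.toHomeomorph.symm.isEmbedding
        |>.discreteTopology).isDiscrete
    · intro t ht
      obtain ⟨n, hn, -⟩ := hval t ht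
      exact ⟨n, hn.symm⟩
  obtain ⟨n, hn, hLn⟩ := hval a (Set.left_mem_Icc.mpr hab)
  obtain ⟨n', hn', hLn'⟩ := hval b (Set.right_mem_Icc.mpr hab)
  have hnn : n = n' := by exact_mod_cast hn.symm.trans (hconst.trans hn')
  subst hnn
  have h3 : (2 * Real.pi * Complex.I : ℂ) * k = 2 * Real.pi * Complex.I * l := by
    rw [← hk, ← hk', hLn, hLn']; ring
  exact_mod_cast mul_left_cancel₀ h2 h3

theorem zero_of_slitPlane (hf : ContinuousOn f (Set.Icc a b))
    (hs : ∀ t ∈ Set.Icc a b, f t ∈ Complex.slitPlane) (hab : f a = f b) :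
    HasWindingNumber f a b 0 :=
  ⟨fun t => Complex.log (f t), hf.clog hs,
    fun t ht => (Complex.exp_log (Complex.slitPlane_ne_zero (hs t ht))).symm, by simp [hab]⟩

end HasWindingNumber

/-- The locus of the Nyquist D-contour of radius `R`, with the part of the imaginary axis extended
to the whole axis. -/
def nyquistLocus (R : ℝ) : Set ℂ :=
  {s | 0 ≤ s.re ∧ (s.re = 0 ∨ ‖s‖ = R)}

theorem nyquistContour_mem {R : ℝ} (hR : 0 ≤ R) {t : ℝ} (ht : t ∈ Set.Icc (-1 : ℝ) 3) :
    nyquistContour R t ∈ nyquistLocus R := by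
  unfold nyquistContour nyquistLocus
  split_ifs with h
  · simp
  · push Not at h
    have harg : (Complex.I * (Real.pi / 2 * (2 - t)) : ℂ) =
        ((Real.pi / 2 * (2 - t) : ℝ) : ℂ) * Complex.I := by push_cast; ring
    rw [harg]
    refine ⟨?_, Or.inr ?_⟩
    · rw [Complex.re_ofReal_mul, Complex.exp_ofReal_mul_I_re]
      refine mul_nonneg hR (Real.cos_nonneg_of_mem_Icc ⟨?_, ?_⟩)
      · nlinarith [Real.pi_pos, ht.2]
      · nlinarith [Real.pi_pos]
    · rw [norm_mul, Complex.norm_exp_ofReal_mul_I, Complex.norm_real, Real.norm_of_nonneg hR,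
        mul_one]

theorem exp_I_pi_div_two : Complex.exp (Complex.I * (Real.pi / 2)) = Complex.I := by
  rw [mul_comm]; exact Complex.exp_pi_div_two_mul_I

theorem continuous_nyquistContour (R : ℝ) : Continuous (nyquistContour R) := by
  refine Continuous.if_le (by fun_prop) (by fun_prop) continuous_id continuous_const ?_
  rintro t rfl
  norm_num [exp_I_pi_div_two, mul_comm]

theorem nyquistContour_neg_one (R : ℝ) : nyquistContour R (-1) = -(Complex.I * R) := by
  rw [nyquistContour, if_pos (by norm_num)]
  push_cast; ring

theorem nyquistContour_three (R : ℝ) : nyquistContour R 3 = -(Complex.I * R) := by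
  rw [nyquistContour, if_neg (by norm_num)]
  have : (Complex.I * (Real.pi / 2 * (2 - (3 : ℝ))) : ℂ) = -(Complex.I * (Real.pi / 2)) := by
    push_cast; ring
  rw [this, Complex.exp_neg, exp_I_pi_div_two, Complex.inv_I]; ring

namespace HasWno

variable {f g : ℂ → ℂ} {k l : ℤ}

theorem congr (hf : HasWno f k) (h : ∀ᶠ R in atTop, ∀ s ∈ nyquistLocus R, f s = g s) :
    HasWno g k := by
  filter_upwards [hf, h, eventually_ge_atTop 0] with R h1 h2 hR
  exact h1.congr fun t ht => h2 _ (nyquistContour_mem hR ht)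

theorem mul (hf : HasWno f k) (hg : HasWno g l) : HasWno (fun s => f s * g s) (k + l) := by
  filter_upwards [hf, hg] with R h1 h2 using h1.mul h2

theorem inv (hf : HasWno f k) : HasWno (fun s => (f s)⁻¹) (-k) := by
  filter_upwards [hf] with R h1 using h1.inv

theorem unique (hf : HasWno f k) (hg : HasWno f l) : k = l := by
  obtain ⟨R, h1, h2⟩ := (Eventually.and hf hg).exists
  exact h1.unique (by norm_num) h2

theorem zero_of_slitPlane
    (h : ∀ᶠ R in atTop, ∀ s ∈ nyquistLocus R, ContinuousAt f s ∧ f s ∈ Complex.slitPlane) :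
    HasWno f 0 := by
  filter_upwards [h, eventually_ge_atTop 0] with R h hR
  refine HasWindingNumber.zero_of_slitPlane (fun t ht => ?_)
    (fun t ht => (h _ (nyquistContour_mem hR ht)).2) ?_
  · exact ((h _ (nyquistContour_mem hR ht)).1.comp
      (continuous_nyquistContour R).continuousAt).continuousWithinAt
  · rw [nyquistContour_neg_one, nyquistContour_three]

theorem const {c : ℂ} (hc : c ≠ 0) : HasWno (fun _ => c) 0 :=
  Eventually.of_forall fun _ => ⟨fun _ => Complex.log c, continuousOn_const,
    fun _ _ => (Complex.exp_log hc).symm, by simp⟩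

theorem sub_const_of_neg {z : ℂ} (hz : z.re < 0) : HasWno (fun s => s - z) 0 := by
  refine zero_of_slitPlane (Eventually.of_forall fun R s hs => ⟨by fun_prop, Or.inl ?_⟩)
  have := hs.1
  simp only [Complex.sub_re]; linarith

/-- The contour runs clockwise once around every point of the open right half plane. A continuous
logarithm of `s - z` is `log (z - s) + πi` on the imaginary axis, and
`log s + log (1 - z / s)` on the semicircle. -/
theorem sub_const_of_pos {z : ℂ} (hz : 0 < z.re) : HasWno (fun s => s - z) (-1) := by
  filter_upwards [eventually_gt_atTop ‖z‖] with R hR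
  have hR0 : 0 < R := (norm_nonneg z).trans_lt hR
  have hRC : (R : ℂ) ≠ 0 := by exact_mod_cast hR0.ne'
  -- the factor `1 - z / s` on the semicircle
  let w : ℝ → ℂ := fun t => 1 - z / (R * Complex.exp (Complex.I * (Real.pi / 2 * (2 - t))))
  have hnorm : ∀ t : ℝ, ‖(R * Complex.exp (Complex.I * (Real.pi / 2 * (2 - t))) : ℂ)‖ = R := by
    intro t
    have harg : (Complex.I * (Real.pi / 2 * (2 - t)) : ℂ) =
        ((Real.pi / 2 * (2 - t) : ℝ) : ℂ) * Complex.I := by push_cast; ring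
    rw [harg, norm_mul, Complex.norm_exp_ofReal_mul_I, Complex.norm_real,
      Real.norm_of_nonneg hR0.le, mul_one]
  have hw : ∀ t, 0 < (w t).re := by
    intro t
    have h1 : ‖z / (R * Complex.exp (Complex.I * (Real.pi / 2 * (2 - t))))‖ < 1 := by
      rw [norm_div, hnorm, div_lt_one hR0]; exact hR
    have h2 := (Complex.re_le_norm _).trans_lt h1
    simp only [w, Complex.sub_re, Complex.one_re]; linarith
  have hwne : ∀ t, w t ≠ 0 := fun t h => by have := hw t; simp [h] at this
  let L₁ : ℝ → ℂ := fun t => Complex.log (z - Complex.I * (R * t)) + Real.pi * Complex.I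
  let L₂ : ℝ → ℂ := fun t =>
    Real.log R + Complex.I * (Real.pi / 2 * (2 - t)) + Complex.log (w t)
  have hre : ∀ t : ℝ, 0 < (z - Complex.I * (R * t)).re := by intro t; simpa using hz
  have hc1 : Continuous L₁ :=
    (Continuous.clog (by fun_prop) fun t => Or.inl (hre t)).add continuous_const
  have hc2 : Continuous L₂ := by
    refine Continuous.add (by fun_prop) (Continuous.clog ?_ fun t => Or.inl (hw t))
    refine continuous_const.sub (continuous_const.div (by fun_prop) fun t => ?_)
    exact mul_ne_zero hRC (Complex.exp_ne_zero _)
  have he1 : ∀ t : ℝ, Complex.exp (L₁ t) = Complex.I * (R * t) - z := by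
    intro t
    simp only [L₁]
    rw [Complex.exp_add, Complex.exp_log (fun h => by have := hre t; simp [h] at this),
      Complex.exp_pi_mul_I]
    ring
  have he2 : ∀ t : ℝ, Complex.exp (L₂ t) =
      R * Complex.exp (Complex.I * (Real.pi / 2 * (2 - t))) - z := by
    intro t
    have hne := mul_ne_zero hRC (Complex.exp_ne_zero (Complex.I * (Real.pi / 2 * (2 - t))))
    simp only [L₂]
    rw [Complex.exp_add, Complex.exp_add, Complex.exp_log (hwne t), ← Complex.ofReal_exp,
      Real.exp_log hR0]
    simp only [w]
    rw [mul_sub, mul_one, mul_div_cancel₀ _ hne]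
  -- both logarithms have an imaginary part in `(0, 3π/2)` at `s = iR`
  have harg : ∀ {u : ℂ}, 0 < u.re → |(Complex.log u).im| < Real.pi / 2 := fun hu => by
    rw [Complex.log_im]; exact Complex.abs_arg_lt_pi_div_two_iff.mpr (Or.inl hu)
  have eq_of_im : ∀ u v : ℂ, Complex.exp u = Complex.exp v → |u.im - v.im| < 2 * Real.pi →
      u = v := by
    intro u v he h
    obtain ⟨n, hn⟩ := Complex.exp_eq_exp_iff_exists_int.mp he
    have him : u.im - v.im = n * (2 * Real.pi) := by
      have := congrArg Complex.im hn
      simp at this; linarith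
    rw [him, abs_mul, abs_of_pos Real.two_pi_pos] at h
    have h1 : |(n : ℝ)| < 1 := by
      by_contra hcon
      push Not at hcon
      nlinarith [Real.two_pi_pos]
    have : n = 0 := by
      rw [← Int.abs_lt_one_iff]; exact_mod_cast h1
    simpa [this] using hn
  have hglue : L₁ 1 = L₂ 1 := by
    apply eq_of_im
    · rw [he1, he2]
      norm_num [exp_I_pi_div_two, mul_comm]
    · have h1 := abs_lt.mp (harg (hre 1))
      have h2 := abs_lt.mp (harg (hw 1))
      have hi2 : (L₂ 1).im = Real.pi / 2 + (Complex.log (w 1)).im := by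
        simp [L₂]; norm_num
      have hi1 : (L₁ 1).im = (Complex.log (z - Complex.I * (R * (1 : ℝ)))).im + Real.pi := by
        simp [L₁]
      rw [hi1, hi2, abs_lt]
      constructor <;> linarith [Real.pi_pos]
  -- at `s = -iR` the two logarithms differ by a full turn
  have hend : L₂ 3 + 2 * Real.pi * Complex.I = L₁ (-1) := by
    apply eq_of_im
    · rw [Complex.exp_add, Complex.exp_two_pi_mul_I, he1, he2, mul_one]
      have : (Complex.I * (Real.pi / 2 * (2 - (3 : ℝ))) : ℂ) = -(Complex.I * (Real.pi / 2)) := by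
        push_cast; ring
      rw [this, Complex.exp_neg, exp_I_pi_div_two, Complex.inv_I]
      push_cast; ring
    · have h1 := abs_lt.mp (harg (hre (-1)))
      have h2 := abs_lt.mp (harg (hw 3))
      have hi2 : (L₂ 3 + 2 * Real.pi * Complex.I).im =
          3 / 2 * Real.pi + (Complex.log (w 3)).im := by
        simp [L₂]; ring
      have hi1 : (L₁ (-1)).im =
          (Complex.log (z - Complex.I * (R * ((-1 : ℝ) : ℂ)))).im + Real.pi := by
        simp [L₁]
      rw [hi1, hi2, abs_lt]
      constructor <;> linarith [Real.pi_pos]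
  refine ⟨fun t => if t ≤ 1 then L₁ t else L₂ t, ?_, ?_, ?_⟩
  · refine (Continuous.if_le hc1 hc2 continuous_id continuous_const ?_).continuousOn
    rintro t rfl
    exact hglue
  · intro t _
    simp only [nyquistContour]
    split_ifs with h
    · exact (he1 t).symm
    · exact (he2 t).symm
  · simp only [show ¬(3 : ℝ) ≤ 1 by norm_num, show (-1 : ℝ) ≤ 1 by norm_num, if_true, if_false,
      ← hend]
    push_cast; ring

/-- The argument principle for polynomials on the Nyquist contour. -/
theorem polynomial {f : ℂ[X]} (hf : f ≠ 0) (hax : ∀ z ∈ f.roots, z.re ≠ 0) :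
    HasWno (fun s => f.eval s) (-(f.roots.countP (fun z => 0 < z.re) : ℕ)) := by
  have key : ∀ S : Multiset ℂ, (∀ z ∈ S, z.re ≠ 0) →
      HasWno (fun s => (S.map fun z => s - z).prod) (-(S.countP (fun z => 0 < z.re) : ℕ)) := by
    intro S
    induction S using Multiset.induction_on with
    | empty => intro _; simpa using HasWno.const one_ne_zero
    | cons z S ih =>
      intro h
      have ih' := ih fun y hy => h y (Multiset.mem_cons_of_mem hy)
      simp only [Multiset.map_cons, Multiset.prod_cons]
      rcases lt_or_gt_of_ne (h z (Multiset.mem_cons_self z S)) with hz | hz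
      · rw [Multiset.countP_cons_of_neg (p := fun z : ℂ => 0 < z.re) S hz.le.not_gt]
        simpa using (sub_const_of_neg hz).mul ih'
      · rw [Multiset.countP_cons_of_pos (p := fun z : ℂ => 0 < z.re) S hz]
        have := (sub_const_of_pos hz).mul ih'
        convert this using 1
        push_cast; ring
  have h := (HasWno.const (Polynomial.leadingCoeff_ne_zero.mpr hf)).mul (key f.roots hax)
  rw [zero_add] at h
  refine h.congr (Eventually.of_forall fun R s _ => ?_)
  rw [(IsAlgClosed.splits f).eval_eq_prod_roots]

theorem polynomial_zero {f : ℂ[X]} (hf : f ≠ 0) (h : ∀ z, f.eval z = 0 → z.re < 0) :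
    HasWno (fun s => f.eval s) 0 := by
  have hr : ∀ z ∈ f.roots, z.re < 0 := fun z hz => h z (Polynomial.isRoot_of_mem_roots hz)
  have := polynomial hf fun z hz => (hr z hz).ne
  rwa [Multiset.countP_eq_zero.mpr fun z hz => (hr z hz).le.not_gt, Nat.cast_zero, neg_zero] at this

end HasWno

/-! ### Rational functions at infinity -/

theorem tendsto_axis_cobounded :
    Tendsto (fun ω : ℝ => Complex.I * ω) atTop (Bornology.cobounded ℂ) := by
  rw [← tendsto_norm_atTop_iff_cobounded]
  simpa using tendsto_abs_atTop_atTop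

namespace Polynomial

theorem tendsto_eval_div_pow_cobounded {f : ℂ[X]} {N : ℕ} (hf : f.natDegree ≤ N) :
    Tendsto (fun s => f.eval s / s ^ N) (Bornology.cobounded ℂ) (𝓝 (f.coeff N)) := by
  have h1 : Tendsto (fun s : ℂ => (f.reflect N).eval s⁻¹) (Bornology.cobounded ℂ)
      (𝓝 ((f.reflect N).eval 0)) :=
    ((f.reflect N).continuous.tendsto 0).comp tendsto_inv₀_cobounded
  have h2 : (f.reflect N).eval 0 = f.coeff N := by
    rw [← coeff_zero_eq_eval_zero, coeff_reflect, revAt_le (Nat.zero_le N), Nat.sub_zero]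
  rw [h2] at h1
  refine h1.congr' ?_
  filter_upwards [Bornology.eventually_ne_cobounded (0 : ℂ)] with s hs
  let _ := invertibleOfNonzero hs
  have h3 := eval₂_reflect_mul_pow (RingHom.id ℂ) s N f hf
  rw [invOf_eq_inv] at h3
  rw [eq_div_iff (pow_ne_zero N hs)]
  exact h3

theorem tendsto_eval_div_eval_cobounded {f g : ℂ[X]} (hg : g ≠ 0)
    (h : f.natDegree ≤ g.natDegree) :
    Tendsto (fun s => f.eval s / g.eval s) (Bornology.cobounded ℂ)
      (𝓝 (f.coeff g.natDegree / g.leadingCoeff)) := by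
  refine ((tendsto_eval_div_pow_cobounded h).div (tendsto_eval_div_pow_cobounded le_rfl)
    (leadingCoeff_ne_zero.mpr hg)).congr' ?_
  filter_upwards [Bornology.eventually_ne_cobounded (0 : ℂ)] with s hs
  simp only [Pi.div_apply]
  rw [div_div_div_cancel_right₀ (pow_ne_zero _ hs)]

theorem natDegree_le_of_axis_bounded {f g : ℂ[X]} {K : ℝ}
    (h : ∀ᶠ ω : ℝ in atTop, ‖f.eval (Complex.I * ω)‖ ≤ K * ‖g.eval (Complex.I * ω)‖) :
    f.natDegree ≤ g.natDegree := by
  by_contra! hlt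
  have hf : f ≠ 0 := by rintro rfl; simp at hlt
  have h1 := (tendsto_eval_div_eval_cobounded hf hlt.le).comp tendsto_axis_cobounded
  rw [coeff_eq_zero_of_natDegree_lt hlt, zero_div] at h1
  have h2 : Tendsto (fun ω : ℝ => K * ‖g.eval (Complex.I * ω) / f.eval (Complex.I * ω)‖) atTop
      (𝓝 0) := by simpa using h1.norm.const_mul K
  have hne : ∀ᶠ ω : ℝ in atTop, f.eval (Complex.I * ω) ≠ 0 := by
    have h3 := (tendsto_eval_div_pow_cobounded (le_refl f.natDegree)).comp tendsto_axis_cobounded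
    filter_upwards [h3.eventually_ne (leadingCoeff_ne_zero.mpr hf)] with ω hω h0
    simp [h0] at hω
  obtain ⟨ω, h4, h5, h6⟩ := ((h2.eventually_lt_const one_pos).and (h.and hne)).exists
  have h7 : 0 < ‖f.eval (Complex.I * ω)‖ := norm_pos_iff.mpr h6
  rw [norm_div, ← mul_div_assoc, div_lt_one h7] at h4
  exact absurd h5 h4.not_ge

/-- A rational function that converges along the imaginary axis converges to the same limit in
all directions. -/
theorem tendsto_div_cobounded_of_axis {f g : ℂ[X]} (hg : g ≠ 0) {l : ℂ}
    (h : Tendsto (fun ω : ℝ => f.eval (Complex.I * ω) / g.eval (Complex.I * ω)) atTop (𝓝 l)) :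
    Tendsto (fun s => f.eval s / g.eval s) (Bornology.cobounded ℂ) (𝓝 l) := by
  have hne : ∀ᶠ ω : ℝ in atTop, g.eval (Complex.I * ω) ≠ 0 := by
    have h3 := (tendsto_eval_div_pow_cobounded (le_refl g.natDegree)).comp tendsto_axis_cobounded
    filter_upwards [h3.eventually_ne (leadingCoeff_ne_zero.mpr hg)] with ω hω h0
    simp [h0] at hω
  have hdeg : f.natDegree ≤ g.natDegree := by
    refine natDegree_le_of_axis_bounded (K := ‖l‖ + 1) ?_
    filter_upwards [hne, h.norm.eventually_le_const (lt_add_one ‖l‖)] with ω h1 h2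
    rwa [norm_div, div_le_iff₀ (norm_pos_iff.mpr h1)] at h2
  have h4 := tendsto_eval_div_eval_cobounded hg hdeg
  rwa [tendsto_nhds_unique h (h4.comp tendsto_axis_cobounded)]

end Polynomial

/-! ### Polynomial fractions of minimal realizations -/

namespace StateSpace

variable {σ ι o : Type} [Fintype σ] [DecidableEq σ]

/-- Controllability makes `sI - A` and `B` left coprime: the constant vectors in the image of
`[sI - A, B]` form an `A`-invariant subspace that contains the range of `B`. -/
theorem IsControllable.exists_bezout [Fintype ι] {P : StateSpace σ ι o} (h : P.IsControllable) :
    ∃ (U : Matrix σ σ ℝ[X]) (V : Matrix ι σ ℝ[X]),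
      charmatrix P.A * U + P.B.map Polynomial.C * V = 1 := by
  let S : Submodule ℝ (σ → ℝ) :=
    { carrier := {x | ∃ (u : σ → ℝ[X]) (v : ι → ℝ[X]),
        charmatrix P.A *ᵥ u + P.B.map Polynomial.C *ᵥ v = fun i => Polynomial.C (x i)}
      add_mem' := by
        rintro x y ⟨u, v, h⟩ ⟨u', v', h'⟩
        refine ⟨u + u', v + v', ?_⟩
        rw [mulVec_add, mulVec_add, add_add_add_comm, h, h']
        ext1 i; simp
      zero_mem' := ⟨0, 0, by ext1 i; simp⟩
      smul_mem' := by
        rintro c x ⟨u, v, h⟩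
        refine ⟨Polynomial.C c • u, Polynomial.C c • v, ?_⟩
        rw [mulVec_smul, mulVec_smul, ← smul_add, h]
        ext1 i; simp }
  have hA : ∀ x ∈ S, P.A *ᵥ x ∈ S := by
    rintro x ⟨u, v, h⟩
    refine ⟨(Polynomial.X : ℝ[X]) • u - fun i => Polynomial.C (x i),
      (Polynomial.X : ℝ[X]) • v, ?_⟩
    rw [mulVec_sub, mulVec_smul, mulVec_smul, sub_add_eq_add_sub, ← smul_add, h, charmatrix,
      sub_mulVec]
    ext1 i
    have h1 : (Polynomial.C.mapMatrix P.A *ᵥ fun i => Polynomial.C (x i)) i =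
        Polynomial.C ((P.A *ᵥ x) i) := by
      simp [mulVec, dotProduct, map_sum]
    rw [RingHom.mapMatrix_apply] at h1
    simp [h1]
  have htop : S = ⊤ := by
    rw [eq_top_iff, ← h, Submodule.span_le]
    rintro _ ⟨⟨i, z⟩, rfl⟩
    simp only [SetLike.mem_coe]
    induction i with
    | zero =>
      refine ⟨0, fun i => Polynomial.C (z i), ?_⟩
      ext1 i
      simp [mulVec, dotProduct, map_sum]
    | succ i ih =>
      have := hA _ ih
      rwa [mulVec_mulVec, ← Matrix.mul_assoc, ← pow_succ'] at this
  have hcol : ∀ j : σ, ∃ (u : σ → ℝ[X]) (v : ι → ℝ[X]),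
      charmatrix P.A *ᵥ u + P.B.map Polynomial.C *ᵥ v =
        fun i => Polynomial.C ((Pi.single j 1 : σ → ℝ) i) := fun j =>
    (htop ▸ Submodule.mem_top : (Pi.single j 1 : σ → ℝ) ∈ S)
  choose U V hUV using hcol
  refine ⟨(Matrix.of U)ᵀ, (Matrix.of V)ᵀ, ?_⟩
  ext1 i j
  have := congrFun (hUV j) i
  simp only [Pi.add_apply] at this
  rw [Matrix.add_apply]
  refine Eq.trans ?_ (this.trans ?_)
  · rfl
  · rw [one_apply, Pi.single_apply]
    split_ifs <;> simp

/-- The dual system `(Aᵀ, Cᵀ, Bᵀ, Dᵀ)`. -/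
def dual (P : StateSpace σ ι o) : StateSpace σ o ι := ⟨P.Aᵀ, P.Cᵀ, P.Bᵀ, P.Dᵀ⟩

theorem IsObservable.dual [Fintype o] {P : StateSpace σ ι o} (h : P.IsObservable) :
    P.dual.IsControllable := by
  by_contra hne
  obtain ⟨f, hf0, hf⟩ := Submodule.exists_le_ker_of_lt_top _ (lt_top_iff_ne_top.mpr hne)
  let x : σ → ℝ := fun i => f (Pi.single i 1)
  have hfx : ∀ y, f y = x ⬝ᵥ y := by
    intro y
    rw [LinearMap.pi_apply_eq_sum_univ f y]
    refine Finset.sum_congr rfl fun i _ => ?_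
    rw [smul_eq_mul, mul_comm]
    congr 2
    ext1 j
    simp [Pi.single_apply, eq_comm]
  have hx : x = 0 := by
    refine h x fun i => ?_
    have h1 : ∀ z : o → ℝ, ((P.C * P.A ^ i) *ᵥ x) ⬝ᵥ z = 0 := by
      intro z
      have h2 : f ((P.dual.A ^ i * P.dual.B) *ᵥ z) = 0 :=
        hf (Submodule.subset_span ⟨(i, z), rfl⟩)
      rw [hfx] at h2
      rw [← h2, dotProduct_mulVec, StateSpace.dual, ← transpose_pow, ← transpose_mul,
        vecMul_transpose]
    exact dotProduct_eq_zero _ h1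
  exact hf0 (LinearMap.ext fun y => by rw [hfx, hx]; simp)

theorem IsObservable.exists_bezout [Fintype o] {P : StateSpace σ ι o} (h : P.IsObservable) :
    ∃ (U : Matrix σ σ ℝ[X]) (V : Matrix σ o ℝ[X]),
      U * charmatrix P.A + V * P.C.map Polynomial.C = 1 := by
  obtain ⟨U, V, hUV⟩ := h.dual.exists_bezout
  refine ⟨Uᵀ, Vᵀ, ?_⟩
  have := congrArg transpose hUV
  rw [transpose_add, transpose_mul, transpose_mul, transpose_one] at this
  rw [← this]
  congr 2
  rw [StateSpace.dual, charmatrix_transpose, transpose_transpose]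

end StateSpace

namespace GraphSymbol

variable {σ ι o : Type} [Fintype σ] [DecidableEq σ] [Fintype ι] [DecidableEq ι] [Fintype o]
  [DecidableEq o] {P : StateSpace σ ι o}

/-- The states driven by `u = m ξ` are polynomial in `ξ`: they are `(sI - A)⁻¹ B m ξ`, and a left
inverse of `[sI - A; C]` recovers them from the polynomial data `B m ξ` and `(n - D m) ξ`. -/
theorem exists_state (G : GraphSymbol P) (hP : P.IsObservable) :
    ∃ W : Matrix σ ι ℝ[X], charmatrix P.A * W = P.B.map Polynomial.C * G.m ∧
      P.C.map Polynomial.C * W + P.D.map Polynomial.C * G.m = G.n := by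
  obtain ⟨U, V, hUV⟩ := hP.exists_bezout
  set φ : ℝ[X] →+* RatFunc ℝ := algebraMap ℝ[X] (RatFunc ℝ) with hφ
  have hinj : Function.Injective φ := IsFractionRing.injective ℝ[X] (RatFunc ℝ)
  have hC : ∀ {a b : Type} (M : Matrix a b ℝ), M.map RatFunc.C = (M.map Polynomial.C).map φ := by
    intro a b M
    ext i j
    simp [hφ]
  have hΔ : Matrix.scalar σ RatFunc.X - P.A.map RatFunc.C = (charmatrix P.A).map φ := by
    ext i j
    by_cases hij : i = j
    · subst hij; simp [hφ]
    · simp [hφ, hij]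
  have hdetΔ : IsUnit ((charmatrix P.A).map φ).det := by
    rw [← RingHom.mapMatrix_apply, ← RingHom.map_det, isUnit_iff_ne_zero]
    exact (map_ne_zero_iff φ hinj).mpr (charpoly_monic P.A).ne_zero
  have hdetm : IsUnit (G.m.map φ).det := by
    rw [← RingHom.mapMatrix_apply, ← RingHom.map_det, isUnit_iff_ne_zero]
    exact (map_ne_zero_iff φ hinj).mpr G.det_m_ne_zero
  have htr : P.transfer = G.n.map φ * (G.m.map φ)⁻¹ := G.transfer_eq
  rw [StateSpace.transfer, hΔ, hC, hC, hC] at htr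
  have hinjM : ∀ {a b : Type} {M N : Matrix a b ℝ[X]}, M.map φ = N.map φ → M = N :=
    fun h => Matrix.map_injective hinj h
  set W₀ := ((charmatrix P.A).map φ)⁻¹ * (P.B.map Polynomial.C).map φ * G.m.map φ with hW₀
  have h1 : (charmatrix P.A).map φ * W₀ = (P.B.map Polynomial.C).map φ * G.m.map φ := by
    rw [hW₀, Matrix.mul_assoc, mul_nonsing_inv_cancel_left _ _ hdetΔ]
  have h2 : (P.C.map Polynomial.C).map φ * W₀ + (P.D.map Polynomial.C).map φ * G.m.map φ =
      G.n.map φ := by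
    have := congrArg (· * G.m.map φ) htr
    simp only [nonsing_inv_mul_cancel_right _ _ hdetm, Matrix.add_mul] at this
    rw [← this, hW₀]
    simp only [Matrix.mul_assoc]
  set W := U * (P.B.map Polynomial.C * G.m) + V * (G.n - P.D.map Polynomial.C * G.m) with hW
  have h3 : W₀ = W.map φ := by
    rw [hW]
    have h4 := congrArg (fun M => M.map φ) hUV
    simp only [Matrix.map_add _ (map_add φ), Matrix.map_mul, Matrix.map_sub _ (map_sub φ),
      Matrix.map_one _ (map_zero φ) (map_one φ)] at h4 ⊢
    rw [← h1, ← h2, add_sub_cancel_right, ← Matrix.mul_assoc (U.map φ),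
      ← Matrix.mul_assoc (V.map φ), ← Matrix.add_mul, h4, Matrix.one_mul]
  refine ⟨W, hinjM ?_, hinjM ?_⟩
  · rw [Matrix.map_mul, Matrix.map_mul, ← h3, h1]
  · rw [Matrix.map_add _ (map_add φ), Matrix.map_mul, Matrix.map_mul, ← h3, h2]

/-- The denominator of a right-coprime fraction and the characteristic polynomial of a minimal
realization agree up to a nonzero constant: `(sI - A) W = B m` with left-coprime `sI - A`, `B` and
right-coprime `W`, `m`, and the two Bézout identities complete `[sI - A, -B]` and `[W; m]` to
mutually inverse unimodular matrices. -/
theorem det_m_eq (G : GraphSymbol P) (hP : P.IsMinimal) :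
    ∃ c : ℝ, c ≠ 0 ∧ G.m.det = Polynomial.C c * P.A.charpoly := by
  obtain ⟨W, hW1, hW2⟩ := G.exists_state hP.2
  obtain ⟨U, V, hUV⟩ := hP.1.exists_bezout
  obtain ⟨X, Y, hXY⟩ := G.coprime
  have hXY' : (Y * P.C.map Polynomial.C) * W + (X + Y * P.D.map Polynomial.C) * G.m = 1 := by
    rw [← hXY, ← hW2]
    simp only [Matrix.mul_add, Matrix.add_mul, Matrix.mul_assoc]
    abel
  set N := fromBlocks U W (-V) G.m with hN
  have h1 : (fromBlocks (charmatrix P.A) (-(P.B.map Polynomial.C)) (Y * P.C.map Polynomial.C)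
      (X + Y * P.D.map Polynomial.C) * N).det = 1 := by
    rw [hN, fromBlocks_multiply, hXY', hW1]
    simp only [Matrix.neg_mul, Matrix.mul_neg, neg_neg, hUV, add_neg_cancel]
    rw [det_fromBlocks_zero₁₂, det_one, det_one, one_mul]
  have hunit : IsUnit N.det := by
    rw [det_mul, mul_comm] at h1
    exact IsUnit.of_mul_eq_one _ h1
  have h2 : (fromBlocks (charmatrix P.A) (-(P.B.map Polynomial.C)) 0 1 * N).det = G.m.det := by
    rw [hN, fromBlocks_multiply, hW1]
    simp only [Matrix.neg_mul, Matrix.mul_neg, neg_neg, hUV, add_neg_cancel, Matrix.zero_mul,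
      Matrix.one_mul, zero_add]
    rw [det_fromBlocks_zero₁₂, det_one, one_mul]
  rw [det_mul, det_fromBlocks_zero₂₁, det_one, mul_one] at h2
  obtain ⟨c, hc, hcN⟩ := Polynomial.isUnit_iff.mp hunit
  exact ⟨c, hc.ne_zero, by rw [← h2, hcN, mul_comm]; rfl⟩

end GraphSymbol

/-! ### Frequency response of a system and of the feedback loop -/

namespace Matrix

variable {κ ι l : Type}

theorem polyEval_mul [Fintype ι] (M : Matrix κ ι ℝ[X]) (N : Matrix ι l ℝ[X]) (s : ℂ) :
    (M * N).polyEval s = M.polyEval s * N.polyEval s :=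
  Matrix.map_mul (f := (Polynomial.aeval s : ℝ[X] →ₐ[ℝ] ℂ))

theorem polyEval_add (M N : Matrix κ ι ℝ[X]) (s : ℂ) :
    (M + N).polyEval s = M.polyEval s + N.polyEval s :=
  Matrix.map_add _ (map_add (Polynomial.aeval s : ℝ[X] →ₐ[ℝ] ℂ)) M N

theorem polyEval_map_C (M : Matrix κ ι ℝ) (s : ℂ) :
    (M.map Polynomial.C).polyEval s = M.map Complex.ofReal := by
  ext i j; simp [polyEval]

theorem det_polyEval [Fintype ι] [DecidableEq ι] (M : Matrix ι ι ℝ[X]) (s : ℂ) :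
    (M.polyEval s).det = Polynomial.aeval s M.det :=
  ((Polynomial.aeval s : ℝ[X] →ₐ[ℝ] ℂ).map_det M).symm

theorem polyEval_charmatrix [Fintype ι] [DecidableEq ι] (A : Matrix ι ι ℝ) (s : ℂ) :
    (charmatrix A).polyEval s = Matrix.scalar ι s - A.map Complex.ofReal := by
  ext i j
  by_cases hij : i = j
  · subst hij; simp [polyEval]
  · simp [polyEval, hij]

theorem det_scalar_sub [Fintype ι] [DecidableEq ι] (A : Matrix ι ι ℝ) (s : ℂ) :
    (Matrix.scalar ι s - A.map Complex.ofReal).det = Polynomial.aeval s A.charpoly := by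
  rw [← polyEval_charmatrix, det_polyEval, charpoly]

theorem map_ofReal_mul [Fintype ι] (M : Matrix κ ι ℝ) (N : Matrix ι l ℝ) :
    (M * N).map Complex.ofReal = M.map Complex.ofReal * N.map Complex.ofReal :=
  Matrix.map_mul (f := Complex.ofRealHom)

theorem map_ofReal_sub (M N : Matrix κ ι ℝ) :
    (M - N).map Complex.ofReal = M.map Complex.ofReal - N.map Complex.ofReal :=
  Matrix.map_sub _ (map_sub Complex.ofRealHom) M N

theorem map_ofReal_one [DecidableEq ι] : (1 : Matrix ι ι ℝ).map Complex.ofReal = 1 :=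
  Matrix.map_one _ (map_zero Complex.ofRealHom) (map_one Complex.ofRealHom)

theorem map_ofReal_inv [Fintype ι] [DecidableEq ι] {M : Matrix ι ι ℝ} (hM : IsUnit M.det) :
    M⁻¹.map Complex.ofReal = (M.map Complex.ofReal)⁻¹ := by
  refine (inv_eq_left_inv ?_).symm
  rw [← map_ofReal_mul, nonsing_inv_mul _ hM, map_ofReal_one]

theorem det_map_ofReal [Fintype ι] [DecidableEq ι] (M : Matrix ι ι ℝ) :
    (M.map Complex.ofReal).det = (M.det : ℂ) :=
  (Complex.ofRealHom.map_det M).symm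

theorem isHurwitz_iff [Fintype ι] [DecidableEq ι] {A : Matrix ι ι ℝ} :
    A.IsHurwitz ↔ ∀ z : ℂ, Polynomial.aeval z A.charpoly = 0 → z.re < 0 := by
  refine forall_congr' fun z => ?_
  have h1 : (A.map Complex.ofReal).charpoly = A.charpoly.map Complex.ofRealHom :=
    Matrix.charpoly_map A Complex.ofRealHom
  rw [mem_spectrum_iff_isRoot_charpoly, h1, Polynomial.IsRoot.def, Polynomial.eval_map]
  rfl

end Matrix

namespace StateSpace

section

variable {σ ι o : Type} [Fintype σ] [DecidableEq σ]

/-- The value `C (sI - A)⁻¹ B + D` of the transfer function, meaningful when `s` is not an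
eigenvalue of `A`. -/
noncomputable def transferAt (P : StateSpace σ ι o) (s : ℂ) : Matrix o ι ℂ :=
  P.C.map Complex.ofReal * (Matrix.scalar σ s - P.A.map Complex.ofReal)⁻¹ * P.B.map Complex.ofReal
    + P.D.map Complex.ofReal

theorem continuousAt_transferAt (P : StateSpace σ ι o) {s : ℂ}
    (hs : Polynomial.aeval s P.A.charpoly ≠ 0) : ContinuousAt P.transferAt s := by
  have h1 : ContinuousAt (fun z : ℂ => (Matrix.scalar σ z - P.A.map Complex.ofReal)⁻¹) s := by
    have hc : Continuous fun z : ℂ => Matrix.scalar σ z - P.A.map Complex.ofReal :=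
      (Continuous.matrix_diagonal (continuous_pi fun _ => continuous_id)).sub continuous_const
    refine ContinuousAt.comp (f := fun z : ℂ => Matrix.scalar σ z - P.A.map Complex.ofReal)
      (continuousAt_matrix_inv _ ?_) hc.continuousAt
    rw [det_scalar_sub, Ring.inverse_eq_inv']
    exact continuousAt_inv₀ hs
  have hc : Continuous fun R : Matrix σ σ ℂ =>
      P.C.map Complex.ofReal * R * P.B.map Complex.ofReal + P.D.map Complex.ofReal := by
    fun_prop
  exact hc.continuousAt.comp h1

theorem tendsto_transferAt (P : StateSpace σ ι o) :
    Tendsto P.transferAt (Bornology.cobounded ℂ) (𝓝 (P.D.map Complex.ofReal)) := by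
  have h1 : Tendsto (fun s : ℂ => (Matrix.scalar σ s - P.A.map Complex.ofReal)⁻¹)
      (Bornology.cobounded ℂ) (𝓝 0) := by
    open scoped Matrix.Norms.L2Operator in
    have := spectrum.resolvent_tendsto_cobounded (𝕜 := ℂ) (P.A.map Complex.ofReal)
    refine this.congr fun s => ?_
    rw [nonsing_inv_eq_ringInverse]
    rfl
  have hc : Continuous fun R : Matrix σ σ ℂ =>
      P.C.map Complex.ofReal * R * P.B.map Complex.ofReal + P.D.map Complex.ofReal := by
    fun_prop
  have h2 := (hc.tendsto 0).comp h1
  rw [Matrix.mul_zero, Matrix.zero_mul, zero_add] at h2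
  exact h2

end

section

variable {σ τ ι o : Type} [Fintype σ] [DecidableEq σ] [Fintype τ] [DecidableEq τ]

theorem scalar_sub_fromBlocks (P : StateSpace σ ι o) (C : StateSpace τ o ι) (s : ℂ) :
    Matrix.scalar (σ ⊕ τ) s - (Matrix.fromBlocks P.A 0 0 C.A).map Complex.ofReal =
      Matrix.fromBlocks (Matrix.scalar σ s - P.A.map Complex.ofReal) 0 0
        (Matrix.scalar τ s - C.A.map Complex.ofReal) := by
  ext i j
  rcases i with i | i <;> rcases j with j | j <;> simp [diagonal_apply]

theorem fromBlocks_resolvent (P : StateSpace σ ι o) (C : StateSpace τ o ι) {s : ℂ}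
    (hP : Polynomial.aeval s P.A.charpoly ≠ 0) (hC : Polynomial.aeval s C.A.charpoly ≠ 0) :
    (Matrix.scalar (σ ⊕ τ) s - (Matrix.fromBlocks P.A 0 0 C.A).map Complex.ofReal) *
      Matrix.fromBlocks (Matrix.scalar σ s - P.A.map Complex.ofReal)⁻¹ 0 0
        (Matrix.scalar τ s - C.A.map Complex.ofReal)⁻¹ = 1 := by
  rw [← det_scalar_sub, ← isUnit_iff_ne_zero] at hP hC
  rw [scalar_sub_fromBlocks, fromBlocks_multiply, mul_nonsing_inv _ hP, mul_nonsing_inv _ hC]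
  simp

variable [DecidableEq ι] [DecidableEq o]

/-- The matrix `[I, C(s); P(s), I]` of the feedback loop at the frequency `s`. -/
noncomputable def loopMatrixAt (P : StateSpace σ ι o) (C : StateSpace τ o ι) (s : ℂ) :
    Matrix (ι ⊕ o) (ι ⊕ o) ℂ :=
  Matrix.fromBlocks 1 (C.transferAt s) (P.transferAt s) 1

theorem tendsto_loopMatrixAt (P : StateSpace σ ι o) (C : StateSpace τ o ι) :
    Tendsto (loopMatrixAt P C) (Bornology.cobounded ℂ)
      (𝓝 ((loopMatrix P C).map Complex.ofReal)) := by
  have hc : Continuous fun x : Matrix ι o ℂ × Matrix o ι ℂ =>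
      (Matrix.fromBlocks 1 x.1 x.2 1 : Matrix (ι ⊕ o) (ι ⊕ o) ℂ) := by
    exact Continuous.matrix_fromBlocks continuous_const continuous_fst continuous_snd
      continuous_const
  have h := (hc.tendsto _).comp (C.tendsto_transferAt.prodMk_nhds P.tendsto_transferAt)
  rw [loopMatrix, fromBlocks_map, map_ofReal_one, map_ofReal_one]
  exact h

/-- The loop matrix at `s` is the Schur complement `L + C (sI - A)⁻¹ B`. -/
theorem loopMatrixAt_eq (P : StateSpace σ ι o) (C : StateSpace τ o ι) (s : ℂ) :
    loopMatrixAt P C s = (loopMatrix P C).map Complex.ofReal +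
      (Matrix.fromBlocks 0 C.C P.C 0).map Complex.ofReal *
        Matrix.fromBlocks (Matrix.scalar σ s - P.A.map Complex.ofReal)⁻¹ 0 0
          (Matrix.scalar τ s - C.A.map Complex.ofReal)⁻¹ *
        (Matrix.fromBlocks P.B 0 0 C.B).map Complex.ofReal := by
  simp only [loopMatrixAt, loopMatrix, transferAt, fromBlocks_map, fromBlocks_multiply,
    fromBlocks_add, map_ofReal_one, Matrix.map_zero _ Complex.ofReal_zero, Matrix.mul_zero,
    Matrix.zero_mul, add_zero, zero_add]
  congr 1 <;> abel

variable [Fintype ι] [Fintype o]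

/-- The closed-loop characteristic polynomial: the determinant of the system pencil
`[sI - A_P ⊕ A_C, B; -C, L]`, where `L` is the loop matrix. It needs no well-posedness. -/
noncomputable def loopPoly (P : StateSpace σ ι o) (C : StateSpace τ o ι) : ℝ[X] :=
  (Matrix.fromBlocks (charmatrix (Matrix.fromBlocks P.A 0 0 C.A))
    ((Matrix.fromBlocks P.B 0 0 C.B).map Polynomial.C)
    (-(Matrix.fromBlocks 0 C.C P.C 0).map Polynomial.C)
    ((loopMatrix P C).map Polynomial.C)).det

theorem det_loopMatrixAt (P : StateSpace σ ι o) (C : StateSpace τ o ι) (s : ℂ) :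
    (loopMatrixAt P C s).det = (1 - C.transferAt s * P.transferAt s).det := by
  rw [loopMatrixAt, det_fromBlocks_one₂₂]

/-- Schur complement of the pencil with respect to its state block. -/
theorem aeval_loopPoly (P : StateSpace σ ι o) (C : StateSpace τ o ι) {s : ℂ}
    (hP : Polynomial.aeval s P.A.charpoly ≠ 0) (hC : Polynomial.aeval s C.A.charpoly ≠ 0) :
    Polynomial.aeval s (loopPoly P C) = Polynomial.aeval s P.A.charpoly *
      Polynomial.aeval s C.A.charpoly * (loopMatrixAt P C s).det := by
  have hinv := fromBlocks_resolvent P C hP hC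
  let _ := invertibleOfRightInverse _ _ hinv
  rw [loopPoly, ← det_polyEval]
  have h1 : ∀ M : Matrix (ι ⊕ o) (σ ⊕ τ) ℝ,
      (-M.map Polynomial.C).polyEval s = -M.map Complex.ofReal := by
    intro M; ext i j; simp [polyEval]
  rw [polyEval, fromBlocks_map]
  change (fromBlocks (polyEval _ s) (polyEval _ s) (polyEval _ s) (polyEval _ s)).det = _
  rw [h1, polyEval_map_C, polyEval_map_C, polyEval_charmatrix, det_fromBlocks₁₁,
    invOf_eq_nonsing_inv, inv_eq_right_inv hinv, Matrix.neg_mul, Matrix.neg_mul, sub_neg_eq_add, ← loopMatrixAt_eq,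
    scalar_sub_fromBlocks, det_fromBlocks_zero₂₁, det_scalar_sub, det_scalar_sub]

/-- Schur complement of the pencil with respect to the loop matrix. -/
theorem loopPoly_eq (P : StateSpace σ ι o) (C : StateSpace τ o ι)
    (h : IsUnit (loopMatrix P C).det) :
    loopPoly P C = Polynomial.C (loopMatrix P C).det * (feedback P C).A.charpoly := by
  have hinv : (loopMatrix P C).map Polynomial.C * (loopMatrix P C)⁻¹.map Polynomial.C = 1 := by
    rw [← Matrix.map_mul, mul_nonsing_inv _ h, Matrix.map_one _ (map_zero _) (map_one _)]
  let _ := invertibleOfRightInverse _ _ hinv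
  rw [loopPoly, det_fromBlocks₂₂, invOf_eq_nonsing_inv, inv_eq_right_inv hinv]
  congr 1
  · exact (RingHom.map_det _ _).symm
  · rw [charpoly]
    congr 1
    simp only [feedback, charmatrix, RingHom.mapMatrix_apply, Matrix.map_sub _ (map_sub _),
      Matrix.map_mul, Matrix.mul_neg]
    abel

/-- The closed loop maps `(u₀, y₀) = [I, C; P, I] (u₁, y₂)` to `(u₁, y₁) = (u₁, P u₁)`. -/
theorem transferAt_feedback_mul (P : StateSpace σ ι o) (C : StateSpace τ o ι)
    (h : IsUnit (loopMatrix P C).det) {s : ℂ}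
    (hP : Polynomial.aeval s P.A.charpoly ≠ 0) (hC : Polynomial.aeval s C.A.charpoly ≠ 0)
    (hPC : Polynomial.aeval s (feedback P C).A.charpoly ≠ 0) :
    (feedback P C).transferAt s * loopMatrixAt P C s =
      Matrix.fromBlocks 1 0 (P.transferAt s) 0 := by
  have hinv := fromBlocks_resolvent P C hP hC
  have hLu : IsUnit ((loopMatrix P C).map Complex.ofReal).det := by
    rw [det_map_ofReal]; exact h.map Complex.ofRealHom
  have hclu : IsUnit
      (Matrix.scalar (σ ⊕ τ) s - (feedback P C).A.map Complex.ofReal).det := by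
    rw [det_scalar_sub]; exact hPC.isUnit
  have hΛ := loopMatrixAt_eq P C s
  have hFs : Matrix.fromBlocks 1 0 (P.transferAt s) 0 =
      (Matrix.fromBlocks 1 0 P.D 0 : Matrix (ι ⊕ o) (ι ⊕ o) ℝ).map Complex.ofReal +
      (Matrix.fromBlocks 0 0 P.C 0 : Matrix (ι ⊕ o) (σ ⊕ τ) ℝ).map Complex.ofReal *
        Matrix.fromBlocks (Matrix.scalar σ s - P.A.map Complex.ofReal)⁻¹ 0 0
          (Matrix.scalar τ s - C.A.map Complex.ofReal)⁻¹ *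
        (Matrix.fromBlocks P.B 0 0 C.B).map Complex.ofReal := by
    simp only [transferAt, fromBlocks_map, fromBlocks_multiply,
      fromBlocks_add, map_ofReal_one, Matrix.map_zero _ Complex.ofReal_zero, Matrix.mul_zero,
      Matrix.zero_mul, add_zero]
    congr 1
    abel
  rw [hFs, transferAt]
  generalize hR : Matrix.fromBlocks (Matrix.scalar σ s - P.A.map Complex.ofReal)⁻¹ 0 0
    (Matrix.scalar τ s - C.A.map Complex.ofReal)⁻¹ = R at hinv hΛ
  generalize loopMatrixAt P C s = Λ at hΛ
  simp only [feedback, map_ofReal_sub, map_ofReal_mul, map_ofReal_inv h] at hclu ⊢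
  generalize (loopMatrix P C).map Complex.ofReal = L at *
  generalize (Matrix.fromBlocks P.A 0 0 C.A).map Complex.ofReal = A at *
  generalize (Matrix.fromBlocks P.B 0 0 C.B).map Complex.ofReal = B at *
  generalize (Matrix.fromBlocks 0 C.C P.C 0).map Complex.ofReal = C₀ at *
  generalize (Matrix.fromBlocks 1 0 P.D 0 : Matrix (ι ⊕ o) (ι ⊕ o) ℝ).map Complex.ofReal = F at *
  generalize (Matrix.fromBlocks 0 0 P.C 0 : Matrix (ι ⊕ o) (σ ⊕ τ) ℝ).map Complex.ofReal = E at *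
  -- the closed-loop states are `(sI - A)⁻¹ B` applied to the solution of the loop equations
  have key : (Matrix.scalar (σ ⊕ τ) s - (A - B * L⁻¹ * C₀))⁻¹ * (B * L⁻¹) * Λ = R * B := by
    have h1 : (Matrix.scalar (σ ⊕ τ) s - (A - B * L⁻¹ * C₀)) * (R * B) = B * L⁻¹ * Λ := by
      have h2 : Matrix.scalar (σ ⊕ τ) s - (A - B * L⁻¹ * C₀) =
          (Matrix.scalar (σ ⊕ τ) s - A) + B * L⁻¹ * C₀ := by abel
      rw [h2, hΛ, Matrix.add_mul, ← Matrix.mul_assoc, hinv, Matrix.one_mul, Matrix.mul_add,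
        nonsing_inv_mul_cancel_right _ _ hLu]
      simp only [Matrix.mul_assoc]
    rw [Matrix.mul_assoc, ← h1, nonsing_inv_mul_cancel_left _ _ hclu]
  have h3 : L⁻¹ * Λ = 1 + L⁻¹ * C₀ * R * B := by
    rw [hΛ, Matrix.mul_add, nonsing_inv_mul _ hLu]
    simp only [Matrix.mul_assoc]
  rw [Matrix.add_mul, Matrix.mul_assoc (E - F * L⁻¹ * C₀), Matrix.mul_assoc (E - F * L⁻¹ * C₀),
    key, Matrix.mul_assoc F L⁻¹ Λ, h3]
  simp only [Matrix.mul_add, Matrix.sub_mul, Matrix.mul_assoc, Matrix.mul_one]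
  abel

end

end StateSpace

namespace GraphSymbol

variable {σ ι o : Type} [Fintype σ] [DecidableEq σ] [Fintype ι] [DecidableEq ι] [Fintype o]
  [DecidableEq o] {P : StateSpace σ ι o}

theorem transferAt_mul_m (G : GraphSymbol P) (hP : P.IsObservable) {s : ℂ}
    (hs : Polynomial.aeval s P.A.charpoly ≠ 0) :
    P.transferAt s * G.m.polyEval s = G.n.polyEval s := by
  obtain ⟨W, h1, h2⟩ := G.exists_state hP
  have h3 := congrArg (fun M => M.polyEval s) h1
  have h4 := congrArg (fun M => M.polyEval s) h2
  simp only [polyEval_mul, polyEval_add, polyEval_map_C, polyEval_charmatrix] at h3 h4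
  rw [← det_scalar_sub] at hs
  rw [StateSpace.transferAt, ← h4, Matrix.add_mul, Matrix.mul_assoc, Matrix.mul_assoc, ← h3,
    nonsing_inv_mul_cancel_left _ _ hs.isUnit]

end GraphSymbol

/-! ### Graph symbols on the imaginary axis and at infinity -/

namespace Matrix

variable {κ ι : Type}

theorem polyEval_polyNeg (M : Matrix κ ι ℝ[X]) (s : ℂ) : M.polyNeg.polyEval s = M.polyEval (-s) := by
  ext i j; simp [polyEval, polyNeg, Polynomial.aeval_comp]

theorem transpose_polyEval_neg {s : ℂ} (hs : s.re = 0) (M : Matrix κ ι ℝ[X]) :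
    (M.polyEval (-s))ᵀ = (M.polyEval s)ᴴ := by
  have hs' : -s = starRingEnd ℂ s := by apply Complex.ext <;> simp [hs]
  ext i j
  simp only [polyEval, transpose_apply, map_apply, conjTranspose_apply, hs', Polynomial.aeval_conj]
  rfl

theorem polyEval_fromRows {l : Type} (M : Matrix κ ι ℝ[X]) (N : Matrix l ι ℝ[X]) (s : ℂ) :
    (fromRows M N).polyEval s = fromRows (M.polyEval s) (N.polyEval s) := by
  ext i j
  rcases i with i | i <;> rfl

theorem continuous_polyEval (M : Matrix κ ι ℝ[X]) : Continuous M.polyEval :=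
  continuous_matrix fun i j => (M i j).continuous_aeval

end Matrix

theorem Polynomial.IsHurwitz.aeval_ne_zero {f : ℝ[X]} (hf : f.IsHurwitz) {s : ℂ} (hs : 0 ≤ s.re) :
    Polynomial.aeval s f ≠ 0 := fun h => (hf.2 s h).not_ge hs

namespace GraphSymbol

variable {σ ι o : Type} [Fintype σ] [DecidableEq σ] [Fintype ι] [DecidableEq ι] [Fintype o]
  [DecidableEq o] {P : StateSpace σ ι o}

theorem eval_eq_fromRows_mul (G : GraphSymbol P) (s : ℂ) :
    G.eval s = (fromRows G.m G.n).polyEval s * (G.d.polyEval s)⁻¹ := by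
  rw [polyEval_fromRows, fromRows_mul]
  rfl

theorem eval_eq_smul (G : GraphSymbol P) (s : ℂ) :
    G.eval s = (Polynomial.aeval s G.d.det)⁻¹ •
      (fromRows G.m G.n * G.d.adjugate).polyEval s := by
  have h : (G.d.polyEval s).adjugate = G.d.adjugate.polyEval s :=
    ((Polynomial.aeval s : ℝ[X] →ₐ[ℝ] ℂ).map_adjugate G.d).symm
  rw [eval_eq_fromRows_mul, inv_def, det_polyEval, Ring.inverse_eq_inv', Matrix.mul_smul, h, polyEval_mul]

theorem transpose_eval_neg (G : GraphSymbol P) {s : ℂ} (hs : s.re = 0) :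
    (G.eval (-s))ᵀ = (G.eval s)ᴴ := by
  rw [eval_eq_fromRows_mul, eval_eq_fromRows_mul, transpose_mul, conjTranspose_mul,
    transpose_nonsing_inv, conjTranspose_nonsing_inv, transpose_polyEval_neg hs,
    transpose_polyEval_neg hs]

theorem conjTranspose_eval_mul_eval (G : GraphSymbol P) {s : ℂ} (hs : s.re = 0) :
    (G.eval s)ᴴ * G.eval s = 1 := by
  have hd : IsUnit (G.d.polyEval s).det := by
    rw [det_polyEval]; exact (G.hurwitz.aeval_ne_zero hs.ge).isUnit
  have h := congrArg (fun M => M.polyEval s) G.factor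
  have htr : ∀ {κ : Type} (M : Matrix κ ι ℝ[X]), (M.polyNegᵀ).polyEval s = (M.polyEval s)ᴴ := by
    intro κ M
    rw [← transpose_polyEval_neg hs, ← polyEval_polyNeg]
    rfl
  simp only [polyEval_add, polyEval_mul, htr] at h
  have hm : ((fromRows G.m G.n).polyEval s)ᴴ * (fromRows G.m G.n).polyEval s =
      (G.d.polyEval s)ᴴ * G.d.polyEval s := by
    rw [← h, polyEval_fromRows, conjTranspose_fromRows_eq_fromCols_conjTranspose,
      fromCols_mul_fromRows, add_comm]
  have hdH : IsUnit (G.d.polyEval s)ᴴ.det := by rw [det_conjTranspose]; exact hd.star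
  rw [eval_eq_fromRows_mul, conjTranspose_mul, conjTranspose_nonsing_inv, Matrix.mul_assoc,
    ← Matrix.mul_assoc ((fromRows G.m G.n).polyEval s)ᴴ, hm, mul_nonsing_inv_cancel_right _ _ hd,
    nonsing_inv_mul _ hdH]

theorem continuousAt_eval (G : GraphSymbol P) {s : ℂ} (hs : Polynomial.aeval s G.d.det ≠ 0) :
    ContinuousAt G.eval s := by
  have h : G.eval = fun s => (Polynomial.aeval s G.d.det)⁻¹ •
      (fromRows G.m G.n * G.d.adjugate).polyEval s := funext G.eval_eq_smul
  rw [h]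
  exact ((G.d.det.continuous_aeval).continuousAt.inv₀ hs).smul
    (continuous_polyEval _).continuousAt

theorem continuous_eval_axis (G : GraphSymbol P) :
    Continuous fun ω : ℝ => G.eval (Complex.I * ω) := by
  refine continuous_iff_continuousAt.mpr fun ω => ?_
  refine ContinuousAt.comp (f := fun ω : ℝ => Complex.I * (ω : ℂ)) (g := G.eval)
    (G.continuousAt_eval (G.hurwitz.aeval_ne_zero (by simp))) (by fun_prop)

/-- A graph symbol is proper: its entries are rational functions bounded by one on the imaginary
axis, so they have limits at infinity. -/
theorem exists_tendsto_eval (G : GraphSymbol P) :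
    ∃ G₀ : Matrix (ι ⊕ o) ι ℂ, Tendsto G.eval (Bornology.cobounded ℂ) (𝓝 G₀) := by
  have hentry : ∀ i j, ∃ l : ℂ,
      Tendsto (fun s => G.eval s i j) (Bornology.cobounded ℂ) (𝓝 l) := by
    intro i j
    let f := ((fromRows G.m G.n * G.d.adjugate) i j).map (algebraMap ℝ ℂ)
    let g := G.d.det.map (algebraMap ℝ ℂ)
    have hfg : ∀ s, G.eval s i j = f.eval s / g.eval s := by
      intro s
      rw [eval_eq_smul, Matrix.smul_apply, smul_eq_mul, div_eq_inv_mul, Polynomial.eval_map_algebraMap,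
        Polynomial.eval_map_algebraMap]
      rfl
    have hg : g ≠ 0 := (Polynomial.map_ne_zero_iff (algebraMap ℝ ℂ).injective).mpr G.hurwitz.1
    have hdeg : f.natDegree ≤ g.natDegree := by
      refine Polynomial.natDegree_le_of_axis_bounded (K := 1) (Eventually.of_forall fun ω => ?_)
      have hgω : g.eval (Complex.I * ω) ≠ 0 := by
        rw [Polynomial.eval_map_algebraMap]
        exact G.hurwitz.aeval_ne_zero (by simp)
      have h1 := congrFun (congrFun (G.conjTranspose_eval_mul_eval (s := Complex.I * ω)
        (by simp)) j) j
      rw [one_apply_eq, mul_apply] at h1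
      have h2 : ∑ k, ‖G.eval (Complex.I * ω) k j‖ ^ 2 = 1 := by
        have h3 : ∀ k, (G.eval (Complex.I * ω))ᴴ j k * G.eval (Complex.I * ω) k j =
            ((‖G.eval (Complex.I * ω) k j‖ ^ 2 : ℝ) : ℂ) := by
          intro k
          rw [conjTranspose_apply, mul_comm]
          push_cast
          exact Complex.mul_conj' _
        simp only [h3] at h1
        exact_mod_cast h1
      have h4 : ‖G.eval (Complex.I * ω) i j‖ ^ 2 ≤ 1 := h2 ▸
        Finset.single_le_sum (f := fun k => ‖G.eval (Complex.I * ω) k j‖ ^ 2)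
          (fun k _ => sq_nonneg _) (Finset.mem_univ i)
      have h5 : ‖G.eval (Complex.I * ω) i j‖ ≤ 1 := by
        nlinarith [norm_nonneg (G.eval (Complex.I * ω) i j)]
      rwa [hfg, norm_div, div_le_iff₀ (norm_pos_iff.mpr hgω)] at h5
    exact ⟨_, (Polynomial.tendsto_eval_div_eval_cobounded hg hdeg).congr fun s => (hfg s).symm⟩
  choose l hl using hentry
  exact ⟨Matrix.of l, tendsto_pi_nhds.mpr fun i => tendsto_pi_nhds.mpr fun j => hl i j⟩

end GraphSymbol

/-! ### Nearby graphs and the parallel projection -/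

namespace Matrix

open scoped Matrix.Norms.L2Operator

variable {κ ι : Type} [Fintype κ] [Fintype ι] [DecidableEq ι]

theorem l2_opNorm_le_one_of_isometry {G : Matrix κ ι ℂ} (hG : Gᴴ * G = 1) : ‖G‖ ≤ 1 := by
  have h1 : ‖(1 : Matrix ι ι ℂ)‖ = ‖(1 : Matrix ι ι ℂ)‖ * ‖(1 : Matrix ι ι ℂ)‖ := by
    have := l2_opNorm_conjTranspose_mul_self (1 : Matrix ι ι ℂ)
    rwa [conjTranspose_one, Matrix.one_mul] at this
  have h2 := l2_opNorm_conjTranspose_mul_self G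
  rw [hG] at h2
  have h3 : ‖(1 : Matrix ι ι ℂ)‖ ≤ 1 := by nlinarith [norm_nonneg (1 : Matrix ι ι ℂ)]
  nlinarith [norm_nonneg G]

variable [DecidableEq κ]

theorem l2_opNorm_one_sub_range_proj_le {G : Matrix κ ι ℂ} (hG : Gᴴ * G = 1) :
    ‖1 - G * Gᴴ‖ ≤ 1 := by
  have h1 : (1 - G * Gᴴ)ᴴ * (1 - G * Gᴴ) = 1 - G * Gᴴ := by
    have h2 : G * Gᴴ * (G * Gᴴ) = G * Gᴴ := by
      rw [Matrix.mul_assoc, ← Matrix.mul_assoc Gᴴ, hG, Matrix.one_mul]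
    rw [conjTranspose_sub, conjTranspose_one, conjTranspose_mul, conjTranspose_conjTranspose,
      Matrix.sub_mul, Matrix.mul_sub, Matrix.mul_sub, h2]
    simp
  have h3 := l2_opNorm_conjTranspose_mul_self (1 - G * Gᴴ)
  rw [h1] at h3
  nlinarith [norm_nonneg (1 - G * Gᴴ)]

/-- Let `T` be the identity on the range of the isometry `G`. If the range of the isometry `H` is
close to that of `G`, then `det (Hᴴ G) det (Gᴴ T H)` has positive real part: with `M = Gᴴ H` and
`N = (1 - G Gᴴ) H` it equals `det (Mᴴ (M + Gᴴ T N)) = det (1 - Nᴴ N + Mᴴ Gᴴ T N)`. -/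
theorem exists_re_det_mul_det_pos (K : ℝ) :
    ∃ ε > 0, ∀ (G H : Matrix κ ι ℂ) (T : Matrix κ κ ℂ), Gᴴ * G = 1 → Hᴴ * H = 1 → T * G = G →
      ‖T‖ ≤ K → ‖(1 - G * Gᴴ) * H‖ ≤ ε → 0 < ((Hᴴ * G).det * (Gᴴ * T * H).det).re := by
  have hcont : Continuous fun F : Matrix ι ι ℂ => ((1 + F).det).re :=
    Complex.continuous_re.comp (continuous_const.add continuous_id).matrix_det
  have hnear : ∀ᶠ F : Matrix ι ι ℂ in 𝓝 0, 0 < ((1 + F).det).re :=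
    (hcont.tendsto 0).eventually_const_lt (by simp)
  obtain ⟨δ, hδ, hball⟩ := Metric.eventually_nhds_iff_ball.mp hnear
  have hε : ∃ ε > 0, |K| * ε + ε * ε < δ := by
    have ht : Tendsto (fun ε : ℝ => |K| * ε + ε * ε) (𝓝[>] 0) (𝓝 0) := by
      have : Continuous fun ε : ℝ => |K| * ε + ε * ε := by fun_prop
      simpa using (this.tendsto 0).mono_left nhdsWithin_le_nhds
    obtain ⟨ε, h1, h2⟩ := ((ht.eventually_lt_const hδ).and self_mem_nhdsWithin).exists
    exact ⟨ε, h2, h1⟩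
  obtain ⟨ε, hε0, hε⟩ := hε
  refine ⟨ε, hε0, fun G H T hG hH hT hK hN => ?_⟩
  set N := (1 - G * Gᴴ) * H with hNdef
  have hH2 : H = G * (Gᴴ * H) + N := by
    rw [hNdef, Matrix.sub_mul, Matrix.one_mul, Matrix.mul_assoc]; abel
  have hGN : Gᴴ * N = 0 := by
    rw [hNdef, ← Matrix.mul_assoc, Matrix.mul_sub, Matrix.mul_one, ← Matrix.mul_assoc, hG,
      Matrix.one_mul, sub_self, Matrix.zero_mul]
  have hNG : Nᴴ * G = 0 := by
    have := congrArg conjTranspose hGN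
    rwa [conjTranspose_mul, conjTranspose_conjTranspose, conjTranspose_zero] at this
  have hM : Hᴴ * G * (Gᴴ * H) = 1 - Nᴴ * N := by
    have h1 : Nᴴ * N = Nᴴ * H := by
      conv_rhs => rw [hH2, Matrix.mul_add, ← Matrix.mul_assoc, hNG, Matrix.zero_mul, zero_add]
    have h2 : Nᴴ = Hᴴ - Hᴴ * (G * Gᴴ) := by
      rw [hNdef, conjTranspose_mul, conjTranspose_sub, conjTranspose_one, conjTranspose_mul,
        conjTranspose_conjTranspose, Matrix.mul_sub, Matrix.mul_one]
    rw [h1, h2, Matrix.sub_mul, hH, sub_sub_cancel]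
    simp only [Matrix.mul_assoc]
  have hE : Gᴴ * T * H = Gᴴ * H + Gᴴ * T * N := by
    conv_lhs => rw [hH2, Matrix.mul_add, ← Matrix.mul_assoc (Gᴴ * T), Matrix.mul_assoc Gᴴ, hT, hG,
      Matrix.one_mul]
  have hdet : (Hᴴ * G).det * (Gᴴ * T * H).det =
      (1 + (Hᴴ * G * (Gᴴ * T * N) - Nᴴ * N)).det := by
    rw [← det_mul, hE, Matrix.mul_add, hM]
    congr 1
    abel
  rw [hdet]
  refine hball _ ?_
  rw [mem_ball_zero_iff]
  have hG1 : ‖Gᴴ‖ ≤ 1 := (l2_opNorm_conjTranspose G).trans_le (l2_opNorm_le_one_of_isometry hG)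
  have hH1 : ‖Hᴴ‖ ≤ 1 := (l2_opNorm_conjTranspose H).trans_le (l2_opNorm_le_one_of_isometry hH)
  have hHG : ‖Hᴴ * G‖ ≤ 1 := (l2_opNorm_mul _ _).trans
    (mul_le_one₀ hH1 (norm_nonneg _) (l2_opNorm_le_one_of_isometry hG))
  have hK' : ‖T‖ ≤ |K| := hK.trans (le_abs_self K)
  have hGT : ‖Gᴴ * T‖ ≤ |K| := (l2_opNorm_mul _ _).trans <|
    (mul_le_mul hG1 hK' (norm_nonneg _) zero_le_one).trans_eq (one_mul _)
  have hGTN : ‖Gᴴ * T * N‖ ≤ |K| * ε := (l2_opNorm_mul _ _).trans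
    (mul_le_mul hGT hN (norm_nonneg _) (abs_nonneg K))
  have hF1 : ‖Hᴴ * G * (Gᴴ * T * N)‖ ≤ |K| * ε := (l2_opNorm_mul _ _).trans <|
    (mul_le_mul hHG hGTN (norm_nonneg _) zero_le_one).trans_eq (one_mul _)
  have hF2 : ‖Nᴴ * N‖ ≤ ε * ε := (l2_opNorm_conjTranspose_mul_self N).trans_le
    (mul_le_mul hN hN (norm_nonneg _) hε0.le)
  exact ((norm_sub_le _ _).trans (add_le_add hF1 hF2)).trans_lt hε

end Matrix

/-! ### The gap bounds the graphs pointwise -/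

namespace GraphSymbol

open scoped Matrix.Norms.L2Operator

variable {σ₁ σ₂ ι o : Type} [Fintype σ₁] [DecidableEq σ₁] [Fintype σ₂] [DecidableEq σ₂]
  [Fintype ι] [DecidableEq ι] [Fintype o] [DecidableEq o]
  {P₁ : StateSpace σ₁ ι o} {P₂ : StateSpace σ₂ ι o}

/-- The gap bounds the distance between the graphs at every frequency. For a short interval `S`
around `ω₀`, the function `1_S G₁ x` belongs to the graph of `G₁`, and pointwise on `S` its distance
from the range of `G₂` is nearly `‖(1 - G₂ G₂ᴴ) G₁ x‖` at `jω₀`. -/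
theorem norm_proj_compl_mul_le_l2Gap (G₁ : GraphSymbol P₁) (G₂ : GraphSymbol P₂) (ω₀ : ℝ) :
    ‖(1 - G₂.eval (Complex.I * ω₀) * (G₂.eval (Complex.I * ω₀))ᴴ) *
      G₁.eval (Complex.I * ω₀)‖ ≤ l2Gap G₁ G₂ := by
  let N : ℝ → Matrix (ι ⊕ o) ι ℂ := fun ω =>
    (1 - G₂.eval (Complex.I * ω) * (G₂.eval (Complex.I * ω))ᴴ) * G₁.eval (Complex.I * ω)
  have hNc : Continuous N :=
    (continuous_const.sub (G₂.continuous_eval_axis.matrix_mul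
      G₂.continuous_eval_axis.matrix_conjTranspose)).matrix_mul G₁.continuous_eval_axis
  have hgap0 : 0 ≤ l2Gap G₁ G₂ := norm_nonneg _
  have hiso₁ : ∀ ω : ℝ, (G₁.eval (Complex.I * ω))ᴴ * G₁.eval (Complex.I * ω) = 1 :=
    fun ω => G₁.conjTranspose_eval_mul_eval (by simp)
  have hiso₂ : ∀ ω : ℝ, (G₂.eval (Complex.I * ω))ᴴ * G₂.eval (Complex.I * ω) = 1 :=
    fun ω => G₂.conjTranspose_eval_mul_eval (by simp)
  rw [l2_opNorm_def]
  refine ContinuousLinearMap.opNorm_le_bound _ hgap0 fun x => ?_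
  change ‖WithLp.toLp 2 (N ω₀ *ᵥ x.ofLp)‖ ≤ _
  have hNx : Continuous fun ω => ‖(WithLp.toLp 2 (N ω *ᵥ x.ofLp) : EuclideanSpace ℂ (ι ⊕ o))‖ :=
    ((PiLp.continuous_toLp 2 _).comp (hNc.matrix_mulVec continuous_const)).norm
  by_contra! hlt
  obtain ⟨c, hc1, hc2⟩ := exists_between hlt
  have hc0 : 0 < c := (mul_nonneg hgap0 (norm_nonneg x)).trans_lt hc1
  obtain ⟨δ, hδ, hball⟩ := Metric.eventually_nhds_iff_ball.mp
    ((hNx.tendsto ω₀).eventually_const_lt hc2)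
  let S : Set ℝ := Metric.ball ω₀ δ
  have hS : MeasurableSet S := measurableSet_ball
  have hSfin : volume S ≠ ⊤ := measure_ball_lt_top.ne
  -- the element `1_S G₁ x` of the graph of `G₁`
  let a : ℝ → EuclideanSpace ℂ (ι ⊕ o) := fun ω =>
    WithLp.toLp 2 (G₁.eval (Complex.I * ω) *ᵥ x.ofLp)
  have hac : Continuous a :=
    (PiLp.continuous_toLp 2 _).comp (G₁.continuous_eval_axis.matrix_mulVec continuous_const)
  have hax : ∀ ω, ‖a ω‖ ≤ ‖x‖ := fun ω =>
    (l2_opNorm_mulVec (G₁.eval (Complex.I * ω)) x).trans <|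
      mul_le_of_le_one_left (norm_nonneg x) (l2_opNorm_le_one_of_isometry (hiso₁ ω))
  have hwmem : MemLp (S.indicator a) 2 volume := by
    refine (memLp_indicator_const 2 hS ‖x‖ (Or.inr hSfin)).mono
      (hac.aestronglyMeasurable.indicator hS) (Eventually.of_forall fun ω => ?_)
    by_cases hω : ω ∈ S
    · simpa [hω] using hax ω
    · simp [hω]
  let w : Lp (EuclideanSpace ℂ (ι ⊕ o)) 2 (volume : Measure ℝ) := hwmem.toLp _
  have hwG : w ∈ G₁.l2Graph := by
    refine ⟨indicatorConstLp 2 hS hSfin x, ?_⟩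
    filter_upwards [hwmem.coeFn_toLp,
      indicatorConstLp_coeFn (p := 2) (hs := hS) (hμs := hSfin) (c := x)] with ω h1 h2
    rw [h1, h2]
    by_cases hω : ω ∈ S
    · simp [hω, a]
    · simp [hω]
  have hwnorm : ‖w‖ ≤ ‖x‖ * volume.real S ^ (1 / (2 : ENNReal).toReal) := by
    rw [← norm_indicatorConstLp (hs := hS) (hμs := hSfin) two_ne_zero ENNReal.ofNat_ne_top]
    refine Lp.norm_le_norm_of_ae_le ?_
    filter_upwards [hwmem.coeFn_toLp,
      indicatorConstLp_coeFn (p := 2) (hs := hS) (hμs := hSfin) (c := x)] with ω h1 h2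
    rw [h1, h2]
    by_cases hω : ω ∈ S
    · simpa [hω] using hax ω
    · simp [hω]
  -- its distance from the graph of `G₂`
  have hdist : ∀ u ∈ G₂.l2Graph,
      c * volume.real S ^ (1 / (2 : ENNReal).toReal) ≤ ‖w - u‖ := by
    rintro u ⟨v, hv⟩
    have hcn : ‖c‖ = c := Real.norm_of_nonneg hc0.le
    rw [← hcn, ← norm_indicatorConstLp (hs := hS) (hμs := hSfin) two_ne_zero
      ENNReal.ofNat_ne_top]
    refine Lp.norm_le_norm_of_ae_le ?_
    filter_upwards [hwmem.coeFn_toLp, Lp.coeFn_sub w u, hv,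
      indicatorConstLp_coeFn (p := 2) (hs := hS) (hμs := hSfin) (c := c)] with ω h1 h2 h3 h4
    rw [h4]
    by_cases hω : ω ∈ S
    · rw [Set.indicator_of_mem hω, h2, Pi.sub_apply, h1, h3, Set.indicator_of_mem hω, hcn]
      refine (hball ω hω).le.trans ?_
      have h5 : N ω *ᵥ x.ofLp = (1 - G₂.eval (Complex.I * ω) * (G₂.eval (Complex.I * ω))ᴴ) *ᵥ
          (G₁.eval (Complex.I * ω) *ᵥ x.ofLp - G₂.eval (Complex.I * ω) *ᵥ (v ω).ofLp) := by
        have h0 : (1 - G₂.eval (Complex.I * ω) * (G₂.eval (Complex.I * ω))ᴴ) *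
            G₂.eval (Complex.I * ω) = 0 := by
          rw [Matrix.sub_mul, Matrix.one_mul, Matrix.mul_assoc, hiso₂, Matrix.mul_one, sub_self]
        rw [mulVec_sub, mulVec_mulVec, mulVec_mulVec, h0, zero_mulVec, sub_zero]
      rw [h5]
      refine (l2_opNorm_mulVec _ (a ω - WithLp.toLp 2
        (G₂.eval (Complex.I * ω) *ᵥ (v ω).ofLp))).trans ?_
      exact mul_le_of_le_one_left (norm_nonneg _) (l2_opNorm_one_sub_range_proj_le (hiso₂ ω))
    · simp [hω]
  have hclosure : ∀ u ∈ G₂.l2Graph.topologicalClosure,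
      c * volume.real S ^ (1 / (2 : ENNReal).toReal) ≤ ‖w - u‖ := by
    intro u hu
    have hcl : IsClosed {u | c * volume.real S ^ (1 / (2 : ENNReal).toReal) ≤ ‖w - u‖} :=
      isClosed_le continuous_const (by fun_prop)
    exact closure_minimal hdist hcl hu
  have h6 : ‖w - G₂.l2Graph.topologicalClosure.starProjection w‖ ≤ l2Gap G₁ G₂ * ‖w‖ := by
    have h7 : G₁.l2Graph.topologicalClosure.starProjection w = w :=
      Submodule.starProjection_eq_self_iff.mpr (G₁.l2Graph.le_topologicalClosure hwG)
    have h8 := (G₁.l2Graph.topologicalClosure.starProjection -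
      G₂.l2Graph.topologicalClosure.starProjection).le_opNorm w
    rwa [_root_.sub_apply, h7] at h8
  have h9 := (hclosure _ (Submodule.starProjection_apply_mem _ w)).trans
    (h6.trans (mul_le_mul_of_nonneg_left hwnorm hgap0))
  have hV : 0 < volume.real S ^ (1 / (2 : ENNReal).toReal) := by
    refine Real.rpow_pos_of_pos ?_ _
    exact ENNReal.toReal_pos (Metric.measure_ball_pos volume ω₀ hδ).ne' hSfin
  rw [← mul_assoc] at h9
  exact absurd (le_of_mul_le_mul_right h9 hV) hc1.not_ge

end GraphSymbol

/-! ### Rational identities on the imaginary axis -/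

/-- Continuous functions on the imaginary axis agree once they agree off the zeros of a nonzero
polynomial. This removes the poles of the plant and of the controller from rational
identities. -/
theorem eq_of_eq_off_roots {X : Type*} [TopologicalSpace X] [T2Space X] {f g : ℝ → X}
    (hf : Continuous f) (hg : Continuous g) {r : ℝ[X]} (hr : r ≠ 0)
    (h : ∀ ω : ℝ, Polynomial.aeval (Complex.I * ω) r ≠ 0 → f ω = g ω) : f = g := by
  have hfin : {ω : ℝ | Polynomial.aeval (Complex.I * ω : ℂ) r = 0}.Finite := by
    have h1 : (r.rootSet ℂ).Finite := Polynomial.rootSet_finite r ℂ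
    refine (h1.preimage (f := fun ω : ℝ => Complex.I * (ω : ℂ)) ?_).subset fun ω hω => ?_
    · intro a _ b _ hab
      exact_mod_cast mul_left_cancel₀ Complex.I_ne_zero hab
    · exact Polynomial.mem_rootSet.mpr ⟨hr, hω⟩
  refine Continuous.ext_on (hfin.countable.dense_compl ℝ) hf hg fun ω hω => h ω hω

theorem eventually_cobounded_aeval_ne_zero {r : ℝ[X]} (hr : r ≠ 0) :
    ∀ᶠ s in Bornology.cobounded ℂ, Polynomial.aeval s r ≠ 0 := by
  have h := (Polynomial.rootSet_finite r ℂ).isBounded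
  filter_upwards [Bornology.isBounded_def.mp h] with s hs h0
  exact hs (Polynomial.mem_rootSet.mpr ⟨hr, h0⟩)

theorem eventually_forall_norm_eq {p : ℂ → Prop} (h : ∀ᶠ s in Bornology.cobounded ℂ, p s) :
    ∀ᶠ R : ℝ in atTop, ∀ s : ℂ, ‖s‖ = R → p s := by
  rw [← comap_norm_atTop, eventually_comap] at h
  exact h

namespace StateSpace

variable {σ τ ι o : Type} [Fintype σ] [DecidableEq σ] [Fintype τ] [DecidableEq τ]
  [Fintype ι] [DecidableEq ι] [Fintype o] [DecidableEq o]
  {P : StateSpace σ ι o} {C : StateSpace τ o ι}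

namespace FeedbackFStable

theorem aeval_charpoly_ne_zero (h : P.FeedbackFStable C) {s : ℂ} (hs : 0 ≤ s.re) :
    Polynomial.aeval s (feedback P C).A.charpoly ≠ 0 :=
  fun h0 => (isHurwitz_iff.mp h.2 s h0).not_ge hs

theorem aeval_loopPoly_ne_zero (h : P.FeedbackFStable C) {s : ℂ} (hs : 0 ≤ s.re) :
    Polynomial.aeval s (loopPoly P C) ≠ 0 := by
  rw [loopPoly_eq P C h.1, map_mul, Polynomial.aeval_C]
  exact mul_ne_zero ((map_ne_zero _).mpr h.1.ne_zero) (h.aeval_charpoly_ne_zero hs)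

theorem continuous_transferAt_axis (h : P.FeedbackFStable C) :
    Continuous fun ω : ℝ => (feedback P C).transferAt (Complex.I * ω) :=
  continuous_iff_continuousAt.mpr fun ω =>
    ContinuousAt.comp (f := fun ω : ℝ => Complex.I * (ω : ℂ))
      ((feedback P C).continuousAt_transferAt (h.aeval_charpoly_ne_zero (by simp))) (by fun_prop)

open scoped Matrix.Norms.L2Operator in
theorem exists_norm_transferAt_le (h : P.FeedbackFStable C) :
    ∃ K : ℝ, ∀ ω : ℝ, ‖(feedback P C).transferAt (Complex.I * ω)‖ ≤ K := by
  have h1 := (feedback P C).tendsto_transferAt.norm.eventually_le_const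
    (lt_add_one ‖(feedback P C).D.map Complex.ofReal‖)
  obtain ⟨R, hR⟩ := (eventually_atTop.mp (eventually_forall_norm_eq h1))
  obtain ⟨K, hK⟩ := (isCompact_Icc (a := -R) (b := R)).exists_bound_of_continuousOn
    h.continuous_transferAt_axis.continuousOn
  refine ⟨max K (‖(feedback P C).D.map Complex.ofReal‖ + 1), fun ω => ?_⟩
  by_cases hω : |ω| ≤ R
  · exact (hK ω (abs_le.mp hω)).trans (le_max_left _ _)
  · exact (hR |ω| (not_le.mp hω).le _ (by simp)).trans (le_max_right _ _)

end FeedbackFStable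

end StateSpace

namespace GraphSymbol

open StateSpace

variable {σ₁ σ₂ τ ι o : Type} [Fintype σ₁] [DecidableEq σ₁] [Fintype σ₂] [DecidableEq σ₂]
  [Fintype τ] [DecidableEq τ] [Fintype ι] [DecidableEq ι] [Fintype o] [DecidableEq o]
  {P : StateSpace σ₁ ι o} {Q : StateSpace σ₂ ι o} {C : StateSpace τ o ι}

theorem eval_eq_transferAt (G : GraphSymbol P) (hP : P.IsObservable) {s : ℂ}
    (hs : Polynomial.aeval s P.A.charpoly ≠ 0) :
    G.eval s = fromRows (G.m.polyEval s * (G.d.polyEval s)⁻¹)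
      (P.transferAt s * (G.m.polyEval s * (G.d.polyEval s)⁻¹)) := by
  rw [← Matrix.mul_assoc, G.transferAt_mul_m hP hs]
  rfl

/-- The closed-loop response is the identity on the graph of the plant. -/
theorem transferAt_feedback_mul_eval (G : GraphSymbol P) (hP : P.IsObservable)
    (hPC : P.FeedbackFStable C) (ω : ℝ) :
    (feedback P C).transferAt (Complex.I * ω) * G.eval (Complex.I * ω) =
      G.eval (Complex.I * ω) := by
  refine congrFun (eq_of_eq_off_roots
    (hPC.continuous_transferAt_axis.matrix_mul G.continuous_eval_axis) G.continuous_eval_axis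
    (mul_ne_zero P.A.charpoly_monic.ne_zero C.A.charpoly_monic.ne_zero) fun ω hω => ?_) ω
  rw [map_mul] at hω
  have h1 := left_ne_zero_of_mul hω
  have h2 := right_ne_zero_of_mul hω
  have h3 := transferAt_feedback_mul P C hPC.1 h1 h2 (hPC.aeval_charpoly_ne_zero (by simp))
  have h4 := G.eval_eq_transferAt hP h1
  generalize G.m.polyEval (Complex.I * ω) * (G.d.polyEval (Complex.I * ω))⁻¹ = M at h4
  have h5 : G.eval (Complex.I * ω) = loopMatrixAt P C (Complex.I * ω) *
      (fromRows M 0 : Matrix (ι ⊕ o) ι ℂ) := by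
    rw [h4, loopMatrixAt, fromBlocks_mul_fromRows]
    simp
  conv_lhs => rw [h5, ← Matrix.mul_assoc, h3, fromBlocks_mul_fromRows]
  rw [h4]
  simp

/-- The loop equations of `[P, C]` driven by an element of the graph of `Q` are
`(1 - C P) u₁ = (1 - C Q) u₀`. -/
theorem det_loopMatrixAt_mul_eq (G : GraphSymbol P) (H : GraphSymbol Q) (hP : P.IsMinimal)
    (hQ : Q.IsObservable) (hPC : P.FeedbackFStable C) {s : ℂ} (hs : s.re = 0)
    (h1 : Polynomial.aeval s P.A.charpoly ≠ 0) (h2 : Polynomial.aeval s C.A.charpoly ≠ 0)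
    (h3 : Polynomial.aeval s Q.A.charpoly ≠ 0) :
    ((G.eval s)ᴴ * (feedback P C).transferAt s * H.eval s).det *
        ((G.m.polyEval s * (G.d.polyEval s)⁻¹).det * (loopMatrixAt P C s).det) =
      (loopMatrixAt Q C s).det * (H.m.polyEval s * (H.d.polyEval s)⁻¹).det := by
  have hT := transferAt_feedback_mul P C hPC.1 h1 h2 (hPC.aeval_charpoly_ne_zero hs.ge)
  have hΛ : IsUnit (loopMatrixAt P C s).det := by
    have h4 := hPC.aeval_loopPoly_ne_zero hs.ge
    rw [aeval_loopPoly P C h1 h2] at h4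
    exact (right_ne_zero_of_mul h4).isUnit
  have hM : IsUnit (G.m.polyEval s * (G.d.polyEval s)⁻¹).det := by
    obtain ⟨c, hc, hcm⟩ := G.det_m_eq hP
    rw [det_mul]
    refine IsUnit.mul ?_ (isUnit_nonsing_inv_det _ ?_)
    · rw [det_polyEval, hcm, map_mul, Polynomial.aeval_C]
      exact (mul_ne_zero ((map_ne_zero _).mpr hc) h1).isUnit
    · rw [det_polyEval]
      exact (G.hurwitz.aeval_ne_zero hs.ge).isUnit
  have hiso := G.conjTranspose_eval_mul_eval hs
  rw [G.eval_eq_transferAt hP.2 h1] at hiso ⊢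
  rw [H.eval_eq_transferAt hQ h3]
  generalize G.m.polyEval s * (G.d.polyEval s)⁻¹ = M at *
  generalize H.m.polyEval s * (H.d.polyEval s)⁻¹ = N at *
  rw [det_loopMatrixAt] at hΛ
  rw [det_loopMatrixAt, det_loopMatrixAt]
  rw [loopMatrixAt] at hT
  generalize (feedback P C).transferAt s = T at *
  generalize P.transferAt s = p at *
  generalize Q.transferAt s = q at *
  generalize C.transferAt s = c at *
  -- the solution `(x, q N - p x)` of the loop equations
  set x := (1 - c * p)⁻¹ * ((1 - c * q) * N) with hx
  have hSx : (1 - c * p) * x = (1 - c * q) * N := by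
    rw [hx, mul_nonsing_inv_cancel_left _ _ hΛ]
  have hloop : fromBlocks 1 c p 1 * fromRows x (q * N - p * x) = fromRows N (q * N) := by
    rw [fromBlocks_mul_fromRows]
    congr 1
    · simp only [Matrix.sub_mul, Matrix.one_mul, Matrix.mul_assoc] at hSx
      rw [Matrix.one_mul, Matrix.mul_sub, ← add_sub_assoc, add_sub_right_comm, hSx]
      abel
    · rw [Matrix.one_mul]; abel
  have hTN : T * fromRows N (q * N) = fromRows M (p * M) * (M⁻¹ * x) := by
    rw [← hloop, ← Matrix.mul_assoc, hT, fromBlocks_mul_fromRows, fromRows_mul,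
      Matrix.mul_assoc p, mul_nonsing_inv_cancel_left _ _ hM]
    simp
  have h4 : M.det * (M⁻¹ * x).det = x.det := by
    rw [← det_mul, mul_nonsing_inv_cancel_left _ _ hM]
  have h5 : (1 - c * p).det * x.det = (1 - c * q).det * N.det := by
    rw [← det_mul, ← det_mul, hSx]
  rw [Matrix.mul_assoc, hTN, ← Matrix.mul_assoc, hiso, Matrix.one_mul]
  linear_combination h5 + (1 - c * p).det * h4

end GraphSymbol

theorem tendsto_det_conjTranspose_mul_mul {α κ ι : Type*} [Fintype κ] [Fintype ι] [DecidableEq ι]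
    {l : Filter α} {g h : α → Matrix κ ι ℂ} {t : α → Matrix κ κ ℂ} {g₀ h₀ : Matrix κ ι ℂ}
    {t₀ : Matrix κ κ ℂ} (hg : Tendsto g l (𝓝 g₀)) (ht : Tendsto t l (𝓝 t₀))
    (hh : Tendsto h l (𝓝 h₀)) :
    Tendsto (fun a => ((g a)ᴴ * t a * h a).det) l (𝓝 (g₀ᴴ * t₀ * h₀).det) := by
  have hc : Continuous fun x : Matrix κ ι ℂ × Matrix κ κ ℂ × Matrix κ ι ℂ =>
      (x.1ᴴ * x.2.1 * x.2.2).det :=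
    ((continuous_fst.matrix_conjTranspose.matrix_mul continuous_snd.fst).matrix_mul
      continuous_snd.snd).matrix_det
  have := (hc.tendsto (g₀, t₀, h₀)).comp (hg.prodMk_nhds (ht.prodMk_nhds hh))
  exact this

theorem tendsto_det_transpose_mul {α κ ι : Type*} [Fintype κ] [Fintype ι] [DecidableEq ι]
    {l : Filter α} {g h : α → Matrix κ ι ℂ} {g₀ h₀ : Matrix κ ι ℂ} (hg : Tendsto g l (𝓝 g₀))
    (hh : Tendsto h l (𝓝 h₀)) : Tendsto (fun a => ((g a)ᵀ * h a).det) l (𝓝 (g₀ᵀ * h₀).det) := by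
  have hc : Continuous fun x : Matrix κ ι ℂ × Matrix κ ι ℂ => (x.1ᵀ * x.2).det :=
    (continuous_fst.matrix_transpose.matrix_mul continuous_snd).matrix_det
  have := (hc.tendsto (g₀, h₀)).comp (hg.prodMk_nhds hh)
  exact this

theorem tendsto_det_conjTranspose_mul {α κ ι : Type*} [Fintype κ] [Fintype ι] [DecidableEq ι]
    {l : Filter α} {g h : α → Matrix κ ι ℂ} {g₀ h₀ : Matrix κ ι ℂ} (hg : Tendsto g l (𝓝 g₀))
    (hh : Tendsto h l (𝓝 h₀)) : Tendsto (fun a => ((g a)ᴴ * h a).det) l (𝓝 (g₀ᴴ * h₀).det) := by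
  have hc : Continuous fun x : Matrix κ ι ℂ × Matrix κ ι ℂ => (x.1ᴴ * x.2).det :=
    (continuous_fst.matrix_conjTranspose.matrix_mul continuous_snd).matrix_det
  have := (hc.tendsto (g₀, h₀)).comp (hg.prodMk_nhds hh)
  exact this

namespace GraphSymbol

open StateSpace

variable {σ₁ σ₂ τ ι o : Type} [Fintype σ₁] [DecidableEq σ₁] [Fintype σ₂] [DecidableEq σ₂]
  [Fintype τ] [DecidableEq τ] [Fintype ι] [DecidableEq ι] [Fintype o] [DecidableEq o]
  {P : StateSpace σ₁ ι o} {Q : StateSpace σ₂ ι o} {C : StateSpace τ o ι}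

/-- On the imaginary axis the determinant of the loop `[P, C]` compressed to the graphs of `P` and
`Q` is the ratio of the closed-loop characteristic polynomials of `[Q, C]` and `[P, C]`, each
normalized by the spectral factor of the plant. -/
theorem exists_det_eq_loopPoly_div (G : GraphSymbol P) (H : GraphSymbol Q) (hP : P.IsMinimal)
    (hQ : Q.IsMinimal) (hPC : P.FeedbackFStable C) :
    ∃ c : ℂ, c ≠ 0 ∧ ∀ ω : ℝ,
      ((G.eval (Complex.I * ω))ᴴ * (feedback P C).transferAt (Complex.I * ω) *
          H.eval (Complex.I * ω)).det =
        c * (Polynomial.aeval (Complex.I * ω) (loopPoly Q C) *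
            Polynomial.aeval (Complex.I * ω) G.d.det) /
          (Polynomial.aeval (Complex.I * ω) (loopPoly P C) *
            Polynomial.aeval (Complex.I * ω) H.d.det) := by
  obtain ⟨a, ha, hma⟩ := G.det_m_eq hP
  obtain ⟨b, hb, hmb⟩ := H.det_m_eq hQ
  have ha' : (a : ℂ) ≠ 0 := by exact_mod_cast ha
  have hb' : (b : ℂ) ≠ 0 := by exact_mod_cast hb
  have hden : ∀ ω : ℝ, Polynomial.aeval (Complex.I * ω : ℂ) (loopPoly P C) *
      Polynomial.aeval (Complex.I * ω : ℂ) H.d.det ≠ 0 := fun ω =>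
    mul_ne_zero (hPC.aeval_loopPoly_ne_zero (by simp)) (H.hurwitz.aeval_ne_zero (by simp))
  have haxis : Continuous fun ω : ℝ => Complex.I * (ω : ℂ) := by fun_prop
  have hpoly : ∀ r : ℝ[X], Continuous fun ω : ℝ => Polynomial.aeval (Complex.I * ω : ℂ) r :=
    fun r => r.continuous_aeval.comp haxis
  refine ⟨b / a, div_ne_zero hb' ha', congrFun (eq_of_eq_off_roots ?_ ?_
    (r := P.A.charpoly * (C.A.charpoly * Q.A.charpoly)) ?_ fun ω hω => ?_)⟩
  · exact ((G.continuous_eval_axis.matrix_conjTranspose.matrix_mul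
      hPC.continuous_transferAt_axis).matrix_mul H.continuous_eval_axis).matrix_det
  · exact (continuous_const.mul ((hpoly _).mul (hpoly _))).div ((hpoly _).mul (hpoly _)) hden
  · exact mul_ne_zero P.A.charpoly_monic.ne_zero
      (mul_ne_zero C.A.charpoly_monic.ne_zero Q.A.charpoly_monic.ne_zero)
  · rw [map_mul, map_mul] at hω
    have h1 := left_ne_zero_of_mul hω
    have h2 := left_ne_zero_of_mul (right_ne_zero_of_mul hω)
    have h3 := right_ne_zero_of_mul (right_ne_zero_of_mul hω)
    have hs : (Complex.I * ω : ℂ).re = 0 := by simp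
    have h4 := G.det_loopMatrixAt_mul_eq H hP hQ.2 hPC hs h1 h2 h3
    have hdG := G.hurwitz.aeval_ne_zero hs.ge
    have hdH := H.hurwitz.aeval_ne_zero hs.ge
    have h5 := aeval_loopPoly P C h1 h2
    have h6 := aeval_loopPoly Q C h3 h2
    have h7 := hPC.aeval_loopPoly_ne_zero hs.ge
    have hinv : ∀ {κ : Type} [Fintype κ] [DecidableEq κ] (d : Matrix κ κ ℝ[X]) (s : ℂ),
        ((d.polyEval s)⁻¹).det = (Polynomial.aeval s d.det)⁻¹ := by
      intro κ _ _ d s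
      rw [det_nonsing_inv, det_polyEval, Ring.inverse_eq_inv']
    rw [det_mul (G.m.polyEval _), det_mul (H.m.polyEval _), hinv, hinv, det_polyEval,
      det_polyEval, hma, hmb, map_mul, map_mul, Polynomial.aeval_C, Polynomial.aeval_C] at h4
    change _ * ((a : ℂ) * _ * _ * _) = _ * ((b : ℂ) * _ * _) at h4
    generalize Polynomial.aeval (Complex.I * ω : ℂ) G.d.det = dG at *
    generalize Polynomial.aeval (Complex.I * ω : ℂ) H.d.det = dH at *
    generalize Polynomial.aeval (Complex.I * ω : ℂ) (loopPoly P C) = ΦP at *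
    generalize Polynomial.aeval (Complex.I * ω : ℂ) (loopPoly Q C) = ΦQ at *
    generalize Polynomial.aeval (Complex.I * ω : ℂ) P.A.charpoly = χP at *
    generalize Polynomial.aeval (Complex.I * ω : ℂ) Q.A.charpoly = χQ at *
    generalize Polynomial.aeval (Complex.I * ω : ℂ) C.A.charpoly = χC at *
    generalize (loopMatrixAt P C (Complex.I * ω)).det = lP at *
    generalize (loopMatrixAt Q C (Complex.I * ω)).det = lQ at *
    rw [eq_div_iff (mul_ne_zero h7 hdH), h5, h6]
    field_simp at h4 ⊢
    linear_combination h4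

/-- If the loop compressed to the graphs is nonsingular at infinity, then `[Q, C]` is
well-posed: the limit of `det_loopMatrixAt_mul_eq` at infinity exhibits `det L_Q` as a factor of a
nonzero number. Here `G₀`, `H₀` and the direct term of the loop `[P, C]` are the values at
infinity. -/
theorem isUnit_det_loopMatrix (G : GraphSymbol P) (H : GraphSymbol Q) (hP : P.IsMinimal)
    (hQ : Q.IsObservable) (hPC : P.FeedbackFStable C) {G₀ H₀ : Matrix (ι ⊕ o) ι ℂ}
    (hG₀ : Tendsto G.eval (Bornology.cobounded ℂ) (𝓝 G₀))
    (hH₀ : Tendsto H.eval (Bornology.cobounded ℂ) (𝓝 H₀)) (hiso : G₀ᴴ * G₀ = 1)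
    (hTG : (feedback P C).D.map Complex.ofReal * G₀ = G₀)
    (hne : (G₀ᴴ * (feedback P C).D.map Complex.ofReal * H₀).det ≠ 0) :
    IsUnit (loopMatrix Q C).det := by
  -- `G₀ = (1 ; D) M₀` for the upper block `M₀` of `G₀`, which is therefore invertible
  have hM₀ : (G₀.toRows₁).det ≠ 0 := by
    set z := ((loopMatrix P C)⁻¹.map Complex.ofReal * G₀).toRows₁ with hz
    have h1 : G₀ = fromRows z (P.D.map Complex.ofReal * z) := by
      conv_lhs => rw [← hTG]
      simp only [feedback, map_ofReal_mul, Matrix.mul_assoc]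
      rw [← fromRows_toRows ((loopMatrix P C)⁻¹.map Complex.ofReal * G₀), fromBlocks_map,
        fromBlocks_mul_fromRows, ← hz]
      simp
    have h2 : G₀ = fromRows 1 (P.D.map Complex.ofReal) * z := by
      rw [fromRows_mul, Matrix.one_mul]; exact h1
    have h3 : G₀.toRows₁ = z := by rw [h1, toRows₁_fromRows]
    have h4 : (G₀ᴴ * (fromRows 1 (P.D.map Complex.ofReal) : Matrix (ι ⊕ o) ι ℂ)) * z = 1 := by
      rw [Matrix.mul_assoc, ← h2, hiso]
    rw [h3]
    intro h0
    have h5 := congrArg det h4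
    rw [det_mul, h0, mul_zero, det_one] at h5
    exact zero_ne_one h5
  have hrows : ∀ {κ : Type} [Fintype κ] [DecidableEq κ] {R : StateSpace κ ι o}
      (F : GraphSymbol R) {F₀ : Matrix (ι ⊕ o) ι ℂ},
      Tendsto F.eval (Bornology.cobounded ℂ) (𝓝 F₀) →
      Tendsto (fun ω : ℝ => (F.m.polyEval (Complex.I * ω) *
        (F.d.polyEval (Complex.I * ω))⁻¹).det) atTop (𝓝 (F₀.toRows₁).det) := by
    intro κ _ _ R F F₀ hF
    have hc : Continuous fun M : Matrix (ι ⊕ o) ι ℂ => (M.toRows₁).det :=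
      (continuous_id.matrix_submatrix Sum.inl id).matrix_det
    exact (hc.tendsto F₀).comp (hF.comp tendsto_axis_cobounded)
  have hloop : ∀ {κ : Type} [Fintype κ] [DecidableEq κ] (R : StateSpace κ ι o),
      Tendsto (fun ω : ℝ => (loopMatrixAt R C (Complex.I * ω)).det) atTop
        (𝓝 ((loopMatrix R C).det : ℂ)) := by
    intro κ _ _ R
    rw [← det_map_ofReal]
    have hc : Continuous fun M : Matrix (ι ⊕ o) (ι ⊕ o) ℂ => M.det := continuous_id.matrix_det
    exact (hc.tendsto _).comp ((tendsto_loopMatrixAt R C).comp tendsto_axis_cobounded)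
  have hcomp := tendsto_det_conjTranspose_mul_mul (hG₀.comp tendsto_axis_cobounded)
    ((feedback P C).tendsto_transferAt.comp tendsto_axis_cobounded)
    (hH₀.comp tendsto_axis_cobounded)
  have hev : ∀ r : ℝ[X], r ≠ 0 → ∀ᶠ ω : ℝ in atTop,
      Polynomial.aeval (Complex.I * ω : ℂ) r ≠ 0 := fun r hr =>
    tendsto_axis_cobounded.eventually (eventually_cobounded_aeval_ne_zero hr)
  have hlim := hcomp.mul ((hrows G hG₀).mul (hloop P))
  have hlim' := (hloop Q).mul (hrows H hH₀)
  have heq := tendsto_nhds_unique_of_eventuallyEq hlim hlim' <| by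
    filter_upwards [hev _ P.A.charpoly_monic.ne_zero, hev _ C.A.charpoly_monic.ne_zero,
      hev _ Q.A.charpoly_monic.ne_zero] with ω h1 h2 h3
    exact G.det_loopMatrixAt_mul_eq H hP hQ hPC (by simp) h1 h2 h3
  have hL : ((loopMatrix P C).det : ℂ) ≠ 0 := by exact_mod_cast hPC.1.ne_zero
  have h8 := mul_ne_zero hne (mul_ne_zero hM₀ hL)
  rw [heq] at h8
  rw [isUnit_iff_ne_zero]
  exact_mod_cast left_ne_zero_of_mul h8

theorem conjTranspose_mul_of_tendsto_eval (G : GraphSymbol P) {G₀ : Matrix (ι ⊕ o) ι ℂ}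
    (hG₀ : Tendsto G.eval (Bornology.cobounded ℂ) (𝓝 G₀)) : G₀ᴴ * G₀ = 1 := by
  have hc : Continuous fun M : Matrix (ι ⊕ o) ι ℂ => Mᴴ * M :=
    continuous_id.matrix_conjTranspose.matrix_mul continuous_id
  have h1 := (hc.tendsto _).comp (hG₀.comp tendsto_axis_cobounded)
  exact tendsto_nhds_unique_of_eventuallyEq h1 tendsto_const_nhds
    (Eventually.of_forall fun ω => G.conjTranspose_eval_mul_eval (by simp))

/-- At infinity `H(-s)ᵀ` has the same limit as `H(s)ᴴ`, because they agree on the imaginary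
axis. -/
theorem tendsto_det_transpose_eval_neg_mul (G : GraphSymbol P) (H : GraphSymbol Q)
    {G₀ H₀ : Matrix (ι ⊕ o) ι ℂ} (hG₀ : Tendsto G.eval (Bornology.cobounded ℂ) (𝓝 G₀))
    (hH₀ : Tendsto H.eval (Bornology.cobounded ℂ) (𝓝 H₀)) :
    Tendsto (fun s => ((H.eval (-s))ᵀ * G.eval s).det) (Bornology.cobounded ℂ)
      (𝓝 (H₀ᴴ * G₀).det) := by
  have h1 := tendsto_det_transpose_mul (hH₀.comp tendsto_neg_cobounded) hG₀
  have h2 := tendsto_det_conjTranspose_mul (hH₀.comp tendsto_axis_cobounded)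
    (hG₀.comp tendsto_axis_cobounded)
  have h3 := tendsto_nhds_unique_of_eventuallyEq (h1.comp tendsto_axis_cobounded) h2 <|
    Eventually.of_forall fun ω => by
      simp only [Function.comp_apply]
      rw [H.transpose_eval_neg (by simp)]
  rw [h3] at h1
  exact h1

end GraphSymbol

/-! ### Robust stability in the gap -/

namespace HasWno

/-- The argument principle on the Nyquist contour for `f g / (u v)` with `g`, `u`, `v` Hurwitz. -/
theorem loop_ratio {f g u v : ℝ[X]} {c : ℂ} (hc : c ≠ 0) (hf : f ≠ 0)
    (hax : ∀ ω : ℝ, Polynomial.aeval (Complex.I * ω : ℂ) f ≠ 0) (hg : g.IsHurwitz)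
    (hu : u.IsHurwitz) (hv : v.IsHurwitz) :
    ∃ N : ℕ, HasWno (fun s => c * (Polynomial.aeval s f * Polynomial.aeval s g) /
        (Polynomial.aeval s u * Polynomial.aeval s v)) (-N) ∧
      (N = 0 ↔ ∀ s : ℂ, Polynomial.aeval s f = 0 → s.re < 0) := by
  have hmap : ∀ (r : ℝ[X]) (s : ℂ), (r.map (algebraMap ℝ ℂ)).eval s = Polynomial.aeval s r :=
    fun r s => Polynomial.eval_map_algebraMap r s
  have hne : ∀ {r : ℝ[X]}, r ≠ 0 → r.map (algebraMap ℝ ℂ) ≠ 0 := fun hr =>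
    (Polynomial.map_ne_zero_iff (algebraMap ℝ ℂ).injective).mpr hr
  have hH : ∀ {r : ℝ[X]}, r.IsHurwitz → HasWno (fun s => Polynomial.aeval s r) 0 := by
    intro r hr
    have := HasWno.polynomial_zero (hne hr.1) fun z hz => hr.2 z (by rwa [hmap] at hz)
    simpa only [hmap] using this
  have hroot : ∀ z, z ∈ (f.map (algebraMap ℝ ℂ)).roots ↔ Polynomial.aeval z f = 0 := fun z => by
    rw [Polynomial.mem_roots (hne hf), Polynomial.IsRoot.def, hmap]
  have hre : ∀ z : ℂ, Polynomial.aeval z f = 0 → z.re ≠ 0 := by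
    intro z hz h0
    refine hax z.im ?_
    have : Complex.I * (z.im : ℂ) = z := by apply Complex.ext <;> simp [h0]
    rwa [this]
  have hf' := HasWno.polynomial (hne hf) fun z hz => hre z ((hroot z).mp hz)
  simp only [hmap] at hf'
  refine ⟨(f.map (algebraMap ℝ ℂ)).roots.countP (fun z => 0 < z.re), ?_, ?_⟩
  · have h := ((HasWno.const hc).mul (hf'.mul (hH hg))).mul (((hH hu).mul (hH hv)).inv)
    simpa [div_eq_mul_inv] using h
  · rw [Multiset.countP_eq_zero]
    refine ⟨fun h z hz => ?_, fun h z hz => (h z ((hroot z).mp hz)).le.not_gt⟩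
    exact lt_of_le_of_ne (not_lt.mp (h z ((hroot z).mpr hz))) (hre z hz)

end HasWno

namespace GraphSymbol

open StateSpace
open scoped Matrix.Norms.L2Operator

variable {σ₁ τ ι o : Type} [Fintype σ₁] [DecidableEq σ₁]
  [Fintype τ] [DecidableEq τ] [Fintype ι] [DecidableEq ι] [Fintype o] [DecidableEq o]
  {P : StateSpace σ₁ ι o} {C : StateSpace τ o ι}

/-- Every plant `Q` in a gap neighbourhood of `P` is stabilized by `C` exactly when the winding
number of `det (H(-s)ᵀ G(s))` vanishes. The radius `ε` does not depend on the state
dimension of `Q`; it is determined by a bound for the closed loop `[P, C]` on the imaginary axis. -/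
theorem exists_l2Gap_le_feedbackFStable_iff (G : GraphSymbol P) (hP : P.IsMinimal)
    (hPC : P.FeedbackFStable C) :
    ∃ ε > 0, ∀ {σ₂ : Type} [Fintype σ₂] [DecidableEq σ₂] {Q : StateSpace σ₂ ι o}
      (H : GraphSymbol Q), Q.IsMinimal → l2Gap H G ≤ ε →
      (Q.FeedbackFStable C ↔ HasWno (fun s => ((H.eval (-s))ᵀ * G.eval s).det) 0) := by
  obtain ⟨K, hK⟩ := hPC.exists_norm_transferAt_le
  obtain ⟨ε, hε, hpos⟩ := exists_re_det_mul_det_pos (κ := ι ⊕ o) (ι := ι) K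
  refine ⟨ε, hε, fun {σ₂} _ _ {Q} H hQ hgap => ?_⟩
  obtain ⟨G₀, hG₀⟩ := G.exists_tendsto_eval
  obtain ⟨H₀, hH₀⟩ := H.exists_tendsto_eval
  have hisoG : ∀ ω : ℝ, (G.eval (Complex.I * ω))ᴴ * G.eval (Complex.I * ω) = 1 :=
    fun ω => G.conjTranspose_eval_mul_eval (by simp)
  have hisoH : ∀ ω : ℝ, (H.eval (Complex.I * ω))ᴴ * H.eval (Complex.I * ω) = 1 :=
    fun ω => H.conjTranspose_eval_mul_eval (by simp)
  have hTG := G.transferAt_feedback_mul_eval hP.2 hPC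
  have hN := fun ω => (H.norm_proj_compl_mul_le_l2Gap G ω).trans hgap
  have haxis := fun ω : ℝ => hpos _ _ _ (hisoG ω) (hisoH ω) (hTG ω) (hK ω) (hN ω)
  -- the same relations hold for the limits at infinity
  have hGax := hG₀.comp tendsto_axis_cobounded
  have hHax := hH₀.comp tendsto_axis_cobounded
  have hTax := (feedback P C).tendsto_transferAt.comp tendsto_axis_cobounded
  have hcomp := tendsto_det_conjTranspose_mul_mul hGax hTax hHax
  have hwell := fun h1 h2 h3 => isUnit_det_loopMatrix (C := C) G H hP hQ.2 hPC hG₀ hH₀ h1 h2 h3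
  generalize (feedback P C).D.map Complex.ofReal = T₀ at hTax hcomp hwell
  have hisoG₀ := G.conjTranspose_mul_of_tendsto_eval hG₀
  have hisoH₀ := H.conjTranspose_mul_of_tendsto_eval hH₀
  have hTG₀ : T₀ * G₀ = G₀ := by
    have hc : Continuous fun x : Matrix (ι ⊕ o) (ι ⊕ o) ℂ × Matrix (ι ⊕ o) ι ℂ => x.1 * x.2 :=
      continuous_fst.matrix_mul continuous_snd
    have h1 := (hc.tendsto (T₀, G₀)).comp (hTax.prodMk_nhds hGax)
    exact tendsto_nhds_unique_of_eventuallyEq h1 hGax (Eventually.of_forall hTG)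
  have hK₀ : ‖T₀‖ ≤ K := le_of_tendsto hTax.norm (Eventually.of_forall hK)
  have hN₀ : ‖(1 - G₀ * G₀ᴴ) * H₀‖ ≤ ε := by
    have hc : Continuous fun x : Matrix (ι ⊕ o) ι ℂ × Matrix (ι ⊕ o) ι ℂ =>
        (1 - x.1 * x.1ᴴ) * x.2 :=
      (continuous_const.sub (continuous_fst.matrix_mul
        continuous_fst.matrix_conjTranspose)).matrix_mul continuous_snd
    have h1 := ((hc.tendsto (G₀, H₀)).comp (hGax.prodMk_nhds hHax)).norm
    exact le_of_tendsto h1 (Eventually.of_forall hN)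
  have hpos₀ := hpos _ _ _ hisoG₀ hisoH₀ hTG₀ hK₀ hN₀
  have hdet₀ : (G₀ᴴ * T₀ * H₀).det ≠ 0 := by
    intro h0; rw [h0, mul_zero] at hpos₀; exact lt_irrefl _ hpos₀
  have hL := hwell hisoG₀ hTG₀ hdet₀
  -- `g` is the function of the statement, `h` extends `det (Gᴴ T H)` off the imaginary axis
  obtain ⟨c, hc, hh⟩ := G.exists_det_eq_loopPoly_div H hP hQ hPC
  set g : ℂ → ℂ := fun s => ((H.eval (-s))ᵀ * G.eval s).det with hg
  set h : ℂ → ℂ := fun s => c * (Polynomial.aeval s (loopPoly Q C) *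
    Polynomial.aeval s G.d.det) / (Polynomial.aeval s (loopPoly P C) *
      Polynomial.aeval s H.d.det) with hhdef
  have hgax : ∀ ω : ℝ, g (Complex.I * ω) =
      ((H.eval (Complex.I * ω))ᴴ * G.eval (Complex.I * ω)).det := fun ω => by
    simp only [hg]; rw [H.transpose_eval_neg (by simp)]
  have hghax : ∀ ω : ℝ, 0 < (g (Complex.I * ω) * h (Complex.I * ω)).re := fun ω => by
    have := haxis ω
    rwa [hh ω, ← hgax] at this
  have hΦP : (loopPoly P C).IsHurwitz := by
    have h1 : ∀ s : ℂ, Polynomial.aeval s (loopPoly P C) = 0 → s.re < 0 := fun s hs => by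
      by_contra! hcon
      exact hPC.aeval_loopPoly_ne_zero hcon hs
    refine ⟨fun h0 => ?_, h1⟩
    have := h1 0 (by rw [h0, map_zero])
    simp at this
  have hcontd : ∀ s : ℂ, 0 ≤ s.re → Polynomial.aeval (-s) H.d.det ≠ 0 →
      ContinuousAt (fun s => g s * h s) s := by
    intro s hs hs'
    have hHc : ContinuousAt (fun s : ℂ => H.eval (-s)) s :=
      ContinuousAt.comp (f := fun s : ℂ => -s) (H.continuousAt_eval hs') continuous_neg.continuousAt
    have hGc := G.continuousAt_eval (G.hurwitz.aeval_ne_zero hs)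
    have hgc : ContinuousAt g s := tendsto_det_transpose_mul hHc.tendsto hGc.tendsto
    refine hgc.mul ?_
    refine ContinuousAt.div (by fun_prop) (by fun_prop) ?_
    exact mul_ne_zero (hΦP.aeval_ne_zero hs) (H.hurwitz.aeval_ne_zero hs)
  -- at infinity `g h` tends to a limit with positive real part
  have hginf := G.tendsto_det_transpose_eval_neg_mul H hG₀ hH₀
  have hhinf : Tendsto h (Bornology.cobounded ℂ) (𝓝 (G₀ᴴ * T₀ * H₀).det) := by
    have h1 : ∀ s, h s =
        ((Polynomial.C c * ((loopPoly Q C).map (algebraMap ℝ ℂ) *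
          G.d.det.map (algebraMap ℝ ℂ))).eval s) /
        (((loopPoly P C).map (algebraMap ℝ ℂ) * H.d.det.map (algebraMap ℝ ℂ)).eval s) := by
      intro s
      simp only [hhdef, Polynomial.eval_mul, Polynomial.eval_C, Polynomial.eval_map_algebraMap]
    have h2 : (loopPoly P C).map (algebraMap ℝ ℂ) * H.d.det.map (algebraMap ℝ ℂ) ≠ 0 :=
      mul_ne_zero ((Polynomial.map_ne_zero_iff (algebraMap ℝ ℂ).injective).mpr hΦP.1)
        ((Polynomial.map_ne_zero_iff (algebraMap ℝ ℂ).injective).mpr H.hurwitz.1)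
    refine (Polynomial.tendsto_div_cobounded_of_axis h2 ?_).congr fun s => (h1 s).symm
    refine hcomp.congr fun ω => ?_
    rw [← h1]
    exact hh ω
  have hghinf : ∀ᶠ s in Bornology.cobounded ℂ,
      0 < (g s * h s).re ∧ Polynomial.aeval (-s) H.d.det ≠ 0 := by
    have h1 := ((Complex.continuous_re.tendsto _).comp (hginf.mul hhinf)).eventually_const_lt hpos₀
    exact h1.and (tendsto_neg_cobounded.eventually (eventually_cobounded_aeval_ne_zero H.hurwitz.1))
  have hlocus : ∀ᶠ R in atTop, ∀ s ∈ nyquistLocus R,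
      ContinuousAt (fun s => g s * h s) s ∧ 0 < (g s * h s).re := by
    filter_upwards [eventually_forall_norm_eq hghinf] with R hR s hs
    rcases hs.2 with h0 | h0
    · have hs' : Complex.I * (s.im : ℂ) = s := by apply Complex.ext <;> simp [h0]
      exact ⟨hcontd s hs.1 (H.hurwitz.aeval_ne_zero (by simp [h0])), hs' ▸ hghax s.im⟩
    · exact ⟨hcontd s hs.1 (hR s h0).2, (hR s h0).1⟩
  have hgh : HasWno (fun s => g s * h s) 0 :=
    HasWno.zero_of_slitPlane (hlocus.mono fun R hR s hs => ⟨(hR s hs).1, Or.inl (hR s hs).2⟩)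
  have hΦax : ∀ ω : ℝ, Polynomial.aeval (Complex.I * ω : ℂ) (loopPoly Q C) ≠ 0 := by
    intro ω h0
    have := hghax ω
    simp [hhdef, h0] at this
  have hΦQ : loopPoly Q C ≠ 0 := fun h0 => hΦax 0 (by rw [h0, map_zero])
  obtain ⟨N, hhN, hN0⟩ := HasWno.loop_ratio hc hΦQ hΦax G.hurwitz hΦP H.hurwitz
  have hstable : Q.FeedbackFStable C ↔ N = 0 := by
    have hL' : ((loopMatrix Q C).det : ℂ) ≠ 0 := by exact_mod_cast hL.ne_zero
    rw [hN0, FeedbackFStable, and_iff_right hL, IsFStable, isHurwitz_iff, loopPoly_eq Q C hL]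
    refine forall_congr' fun s => ?_
    rw [map_mul, Polynomial.aeval_C, mul_eq_zero, or_iff_right]
    exact hL'
  -- `wno h = -N` and `wno (g h) = 0`
  rw [hstable]
  constructor
  · rintro rfl
    have h1 := hgh.mul hhN.inv
    simp only [Nat.cast_zero, neg_zero, add_zero] at h1
    refine h1.congr (hlocus.mono fun R hR s hs => ?_)
    have h2 : h s ≠ 0 := fun h0 => by
      have := (hR s hs).2
      rw [h0, mul_zero] at this
      exact lt_irrefl _ this
    exact mul_inv_cancel_right₀ h2 (g s)
  · intro h1
    have h2 := (h1.mul hhN).unique hgh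
    simpa using h2

end GraphSymbol

theorem mainTheorem2 {p q kP kC : ℕ} (k : ℕ → ℕ)
    (P : StateSpace (Fin kP) (Fin p) (Fin q))
    (C : StateSpace (Fin kC) (Fin q) (Fin p))
    (Pn : (n : ℕ) → StateSpace (Fin (k n)) (Fin p) (Fin q))
    (hP : P.IsMinimal) (hC : C.IsMinimal) (hPn : ∀ n, (Pn n).IsMinimal)
    (G : GraphSymbol P) (Gn : (n : ℕ) → GraphSymbol (Pn n))
    (hPC : P.FeedbackFStable C)
    (hgap : Tendsto (fun n => GraphSymbol.l2Gap (Gn n) G) atTop (𝓝 0)) :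
    (∀ᶠ n in atTop, (Pn n).FeedbackFStable C) ↔
      ∀ᶠ n in atTop, HasWno (fun s => (((Gn n).eval (-s))ᵀ * G.eval s).det) 0 := by
  obtain ⟨ε, hε, h⟩ := G.exists_l2Gap_le_feedbackFStable_iff hP hPC
  refine eventually_congr ?_
  filter_upwards [hgap.eventually_le_const hε] with n hn
  exact h (Gn n) (hPn n) hn
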